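/- Let $\mathbf{A}$ be a commutative ring, $A\in\mathbf{A}^{m\times n}$ a matrix and $k\ge 0$ an integer. \emph{Notation.} A polynomial over $\mathbf{A}$ is \emph{primitive} if its coefficients generate the unit ideal, and $\mathbf{A}(t)=S^{-1}\mathbf{A}[t]$ is the localization (Nagata ring) at the monoid $S$ of primitive polynomials. Let $Q_r=\mathrm{diag}(1,t,\dots,t^{r-1})$, let $A^\circ=Q_n^{-1}\,{}^{t}\!A\,Q_m\in\mathbf{A}(t)^{n\times m}$, and let $$P(Z)=\det(I_m+Z\,AA^\circ)=\sum_{\ell\ge 0}g_\ell(t)Z^\ell ,\qquad g_0=1,$$ $$\mathrm{Adj}^{(k)}_{A^\circ}(A)=g_{k-1}A^\circ-g_{k-2}A^\circ A A^\circ+\dots+(-1)^{k-1}(A^\circ A)^{k-1}A^\circ$$ (which is $0$ for $k=0$). Then $t^{k(n-k)}g_k(t)$ is a polynomial in $t$. \emph{Definitions}, for a matrix $M$ of size $m\times n$ over a commutative ring $\mathbf{B}$. Let $\mathcal{D}_k(M)$ be the ideal generated by the minors of order $k$ of $M$ (so $\mathcal{D}_0(M)=\langle1\rangle$, and $\mathcal{D}_k(M)=0$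 if $k>\min(m,n)$). The matrix $M$ has \emph{rank $\le k$} if its minors of order $k+1$ vanish, and \emph{rank $k$} if $\mathcal{D}_k(M)=\langle 1\rangle$ and $\mathcal{D}_{k+1}(M)=0$. It is \emph{locally simple} if it has a generalized inverse, i.e. there is $N$ with $MNM=M$ and $NMN=N$. It is \emph{simple of rank $k$} if there are bases $(e_i)$ of $\mathbf{B}^n$ and $(f_i)$ of $\mathbf{B}^m$ (each with at least $k$ elements) with $Me_i=f_i$ for $i\le k$ and $Me_i=0$ for $i>k$; over the zero ring, every matrix is simple of every rank. Matrices $M\in\mathbf{B}^{m\times n}$ and $M'\in\mathbf{B}^{n\times m}$ are \emph{crossed} if $\mathbf{B}^m=\mathrm{Im}\,M\oplus\mathrm{Ker}\,M'$ and $\mathbf{B}^n=\mathrm{Ker}\,M\oplus\mathrm{Im}\,M'$; they are \emph{crossed of rank $k$} if moreover both have rank $k$. A \emph{generalized inverse of $M$ via $M'$} is a generalized inverse $N$ of $M$ such that $MN$ is the projection onto $\mathrm{Im}\,M$ parallel to $\mathrm{Ker}\,M'$ and $NM$ is the projection onto $\mathrm{Im}\,M'$ parallel to $\mathrm{Ker}\,M$.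 \textbf{Theorem.} The following properties are equivalent: \begin{enumerate} \item $A$ is locally simple of rank $k$ over $\mathbf{A}$. \item $A$ is locally simple of rank $k$ over $\mathbf{A}(t)$. \item $A$ is simple of rank $k$ over $\mathbf{A}(t)$. \item $A$ has rank $\le k$ and the polynomial $t^{k(n-k)}g_k(t)$ is primitive. \item $A$ and $A^\circ$ are crossed of rank $k$ over $\mathbf{A}(t)$. \item $A$ and $A^\circ$ are crossed over $\mathbf{A}(t)$, $\deg_Z P\le k$, and $t^{k(n-k)}g_k(t)$ is primitive. \item $\deg_Z P\le k$, $t^{k(n-k)}g_k(t)$ is primitive, and $A\cdot\mathrm{Adj}^{(k)}_{A^\circ}(A)\cdot A=g_k(t)\,A$. \end{enumerate} If $\mathbf{A}$ is reduced, the equation in (7) can be dropped: (1)--(7) are then equivalent to "$\deg_Z P\le k$ and $t^{k(n-k)}g_k(t)$ is primitive". When these properties hold, $g_k(t)$ is a unit of $\mathbf{A}(t)$, and the matrix $\mathrm{Adj}^{(k)}_{A^\circ}(A)/g_k(t)$ is the (unique) generalized inverse of $A$ via $A^\circ$ over $\mathbf{A}(t)$. -/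

import Mathlib

noncomputable section

namespace GenInv

open Polynomial

/-! ### Matrices over a commutative ring -/

section Matrices

variable {R : Type*} [CommRing R] {m n : ℕ}

/-- The determinantal ideal `𝒟_k(A)`, generated by the minors of order `k`. The minor of order `0`
is `1`, and there are no minors of order `k > min m n`, in which case the ideal is `0`. -/
def detIdeal (k : ℕ) (A : Matrix (Fin m) (Fin n) R) : Ideal R :=
  Ideal.span (Set.range fun p : (Fin k ↪o Fin m) × (Fin k ↪o Fin n) =>
    (A.submatrix p.1 p.2).det)

/-- `A` is of rank `≤ k`: all minors of order `k + 1` vanish. -/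
def RankLE (A : Matrix (Fin m) (Fin n) R) (k : ℕ) : Prop :=
  ∀ (α : Fin (k + 1) ↪o Fin m) (β : Fin (k + 1) ↪o Fin n), (A.submatrix α β).det = 0

/-- `A` is of rank `k`: `𝒟_k(A) = ⟨1⟩` and `𝒟_{k+1}(A) = ⟨0⟩`. -/
def HasRank (A : Matrix (Fin m) (Fin n) R) (k : ℕ) : Prop :=
  detIdeal k A = ⊤ ∧ detIdeal (k + 1) A = ⊥

/-- `A` is locally simple: it has a generalized inverse. -/
def LocallySimple (A : Matrix (Fin m) (Fin n) R) : Prop :=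
  ∃ B : Matrix (Fin n) (Fin m) R, A * B * A = A ∧ B * A * B = B

/-- `A` is locally simple of rank `k`. -/
def LocallySimpleOfRank (A : Matrix (Fin m) (Fin n) R) (k : ℕ) : Prop :=
  LocallySimple A ∧ HasRank A k

/-- `A` is simple of rank `k`: on suitable bases `e` of `R^n` and `f` of `R^m`, the map `A` sends
the `i`-th vector of `e` to the `i`-th vector of `f` for the first `k` vectors, and sends the other
vectors of `e` to `0`. The bases are indexed by `k + p` and `k + q` elements; over a nontrivial ring
this forces `k + p = n` and `k + q = m`, while over the zero ring every matrix is simple of every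
rank. -/
def SimpleOfRank (A : Matrix (Fin m) (Fin n) R) (k : ℕ) : Prop :=
  ∃ (p q : ℕ) (e : Module.Basis (Fin k ⊕ Fin p) R (Fin n → R))
    (f : Module.Basis (Fin k ⊕ Fin q) R (Fin m → R)),
    (∀ i : Fin k, A.mulVec (e (Sum.inl i)) = f (Sum.inl i)) ∧
      ∀ j : Fin p, A.mulVec (e (Sum.inr j)) = 0

/-- The image of the linear map `R^n → R^m` with matrix `A`. -/
def im (A : Matrix (Fin m) (Fin n) R) : Submodule R (Fin m → R) :=
  LinearMap.range A.mulVecLin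

/-- The kernel of the linear map `R^n → R^m` with matrix `A`. -/
def ker (A : Matrix (Fin m) (Fin n) R) : Submodule R (Fin n → R) :=
  LinearMap.ker A.mulVecLin

/-- `A` and `A'` are crossed: `Im A ⊕ Ker A' = R^m` and `Ker A ⊕ Im A' = R^n`. -/
def Crossed (A : Matrix (Fin m) (Fin n) R) (A' : Matrix (Fin n) (Fin m) R) : Prop :=
  IsCompl (im A) (ker A') ∧ IsCompl (ker A) (im A')

/-- `A` and `A'` are crossed, of rank `k`. -/
def CrossedOfRank (A : Matrix (Fin m) (Fin n) R) (A' : Matrix (Fin n) (Fin m) R) (k : ℕ) : Prop :=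
  Crossed A A' ∧ HasRank A k ∧ HasRank A' k

/-- `P` is the projection onto `I` parallel to `K` (in particular `R^n = I ⊕ K`). -/
def IsProjection (P : Matrix (Fin n) (Fin n) R) (I K : Submodule R (Fin n → R)) : Prop :=
  IsCompl I K ∧ (∀ x ∈ I, P.mulVec x = x) ∧ ∀ x ∈ K, P.mulVec x = 0

/-- `B` is the generalized inverse of `A` via `A'`: it is a generalized inverse of `A`, `A B` is
the projection onto `Im A` parallel to `Ker A'`, and `B A` is the projection onto `Im A'` parallel
to `Ker A`. -/
structure IsGenInverseVia (A : Matrix (Fin m) (Fin n) R) (A' B : Matrix (Fin n) (Fin m) R) :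
    Prop where
  mul_mul_left : A * B * A = A
  mul_mul_right : B * A * B = B
  proj_left : IsProjection (A * B) (im A) (ker A')
  proj_right : IsProjection (B * A) (im A') (ker A)

/-- The polynomial `det (I + Z M)` in the indeterminate `Z`. -/
def detPoly (M : Matrix (Fin m) (Fin m) R) : R[X] :=
  (1 + (X : R[X]) • M.map C).det

/-- `Adj^{(k)}_{A'}(A) = a_{k-1} A' - a_{k-2} A' A A' + ⋯ + (-1)^{k-1} (A' A)^{k-1} A'`,
where `a_j` is the coefficient of `Z^j` in `det (I + Z A A')`. -/
def genAdj (k : ℕ) (A : Matrix (Fin m) (Fin n) R) (A' : Matrix (Fin n) (Fin m) R) :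
    Matrix (Fin n) (Fin m) R :=
  ∑ i ∈ Finset.range k,
    ((-1) ^ i * (detPoly (A * A')).coeff (k - 1 - i)) • ((A' * A) ^ i * A')

end Matrices

/-! ### The Nagata ring `R(t)` -/

section Nagata

variable (R : Type*) [CommRing R]

/-- The monoid of primitive polynomials: those whose coefficients generate the unit ideal. -/
def primitiveSubmonoid : Submonoid R[X] where
  carrier := {p | p.contentIdeal = ⊤}
  one_mem' := by simp
  mul_mem' := fun hp hq => contentIdeal_mul_eq_top_of_contentIdeal_eq_top hp hq

theorem X_mem_primitiveSubmonoid : (X : R[X]) ∈ primitiveSubmonoid R := by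
  change (X : R[X]).contentIdeal = ⊤
  rw [Ideal.eq_top_iff_one]
  have h := (X : R[X]).coeff_mem_contentIdeal 1
  rwa [coeff_X_one] at h

/-- The Nagata ring `R(t)`: the polynomial ring `R[t]` localized at the primitive polynomials. -/
abbrev Nagata : Type _ := Localization (primitiveSubmonoid R)

/-- The indeterminate `t`, as a unit of `R(t)`. -/
def tUnit : (Nagata R)ˣ :=
  (IsLocalization.map_units (Nagata R)
    (⟨X, X_mem_primitiveSubmonoid R⟩ : primitiveSubmonoid R)).unit

/-- The diagonal matrix `Q_n = diag(1, t, …, t^{n-1})` over `R(t)`. -/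
def Q (n : ℕ) : Matrix (Fin n) (Fin n) (Nagata R) :=
  Matrix.diagonal fun i => (tUnit R : Nagata R) ^ (i : ℕ)

theorem isUnit_det_Q (n : ℕ) : IsUnit (Q R n).det := by
  rw [Q, Matrix.det_diagonal]
  exact IsUnit.prod_univ_iff.mpr fun i => (tUnit R).isUnit.pow _

variable {R} {m n : ℕ}

/-- The matrix `A`, viewed over `R(t)`. -/
def overNagata (A : Matrix (Fin m) (Fin n) R) : Matrix (Fin m) (Fin n) (Nagata R) :=
  A.map (algebraMap R (Nagata R))

/-- `A° = Q_n⁻¹ ᵗA Q_m`. -/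
def circ (A : Matrix (Fin m) (Fin n) R) : Matrix (Fin n) (Fin m) (Nagata R) :=
  (Q R n)⁻¹ * (overNagata A).transpose * Q R m

/-- The polynomial `det (I + Z A A°)` in `Z`. -/
def gramPoly (A : Matrix (Fin m) (Fin n) R) : (Nagata R)[X] :=
  detPoly (overNagata A * circ A)

/-- `g_k(t)`, the coefficient of `Z^k` in `det (I + Z A A°)`. -/
def gram (A : Matrix (Fin m) (Fin n) R) (k : ℕ) : Nagata R :=
  (gramPoly A).coeff k

/-- `t^{k(n-k)} g_k(t)` is a primitive polynomial. The exponent is an integer. -/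
def GramPrimitive (A : Matrix (Fin m) (Fin n) R) (k : ℕ) : Prop :=
  ∃ p : R[X], p.contentIdeal = ⊤ ∧
    algebraMap R[X] (Nagata R) p =
      ((tUnit R ^ ((k : ℤ) * ((n : ℤ) - (k : ℤ))) : (Nagata R)ˣ) : Nagata R) * gram A k

end Nagata

end GenInv

end

/-! Every condition is compared with "the minors of order `k` generate the unit ideal and those of
order `k + 1` vanish". This already yields a generalized inverse (`HasRank.locallySimple`), and it
passes both ways between `R` and `R(t)`, since `R` embeds in `R(t)` and proper ideals stay proper
there.

Vandermonde matrices in sparse powers of `t` combine all the minors of order `k` into a single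
primitive polynomial, invertible in `R(t)` (`exists_isUnit_det`). A matrix `A` of rank `k` is
therefore simple over `R(t)` and factors as `F E` through a free module of rank `k`. The
factorization gives the degree bound and, by Cayley-Hamilton in size `k`, the equation with
`genAdj`. It also gives `g_k = det(E Q_n⁻¹ Eᵀ) det(Fᵀ Q_m F)`, so that `A` and `A°` are crossed as
soon as `g_k` is a unit. Primitivity is tested modulo each maximal ideal: over a field, a diagonal
form with distinct powers of `t` does not degenerate on a subspace defined over the constants
(`det_transpose_mul_diagonal_mul_ne_zero`).

Conversely, `g_k` is a combination of minors of order `k`, so its primitivity makes them generate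
the unit ideal. The degree bound only makes the minors of order `k + 1` nilpotent, which is enough
over a reduced ring. In general the equation supplies a generalized inverse, which forces these
minors to vanish (`rankLE_of_detIdeal_le_nilradical`). For crossed matrices the equation comes from
Cayley-Hamilton in size `m`, by cancelling powers of `A A°`, which is injective on `Im A`. -/

namespace GenInv

open Polynomial Matrix

/-! ### Minors, determinantal ideals and generalized inverses -/

section Minors

variable {R : Type*} [CommRing R] {m n : ℕ}

/-- Multilinearity in the rows. Summing over all maps, not only increasing ones, avoids the
regrouping of Cauchy-Binet and loses nothing for ideal membership. -/
theorem det_mul_eq_sum {κ ι : Type*} [Fintype κ] [DecidableEq κ] [Fintype ι]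
    (F : Matrix κ ι R) (X : Matrix ι κ R) :
    (F * X).det = ∑ f : κ → ι, (∏ a, F a (f a)) * (X.submatrix f id).det := by
  classical
  have h : F * X = fun a => ∑ i, F a i • X i := by
    ext a b
    simp [Matrix.mul_apply]
  rw [h]
  change detRowAlternating.toMultilinearMap (fun a => ∑ i, F a i • X i) = _
  rw [MultilinearMap.map_sum]
  refine Finset.sum_congr rfl fun f _ => ?_
  rw [MultilinearMap.map_smul_univ]
  rfl

theorem det_mul_eq_sum' {κ ι : Type*} [Fintype κ] [DecidableEq κ] [Fintype ι]
    (X : Matrix κ ι R) (E : Matrix ι κ R) :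
    (X * E).det = ∑ g : κ → ι, (∏ b, E (g b) b) * (X.submatrix id g).det := by
  rw [← det_transpose, transpose_mul, det_mul_eq_sum]
  refine Finset.sum_congr rfl fun g _ => ?_
  rw [← det_transpose (X.submatrix id g)]
  rfl

theorem det_mul_mul_eq_sum {κ ι ι' : Type*} [Fintype κ] [DecidableEq κ] [Fintype ι] [Fintype ι']
    (F : Matrix κ ι R) (X : Matrix ι ι' R) (E : Matrix ι' κ R) :
    (F * X * E).det = ∑ f : κ → ι, ∑ g : κ → ι',
      (∏ a, F a (f a)) * (∏ b, E (g b) b) * (X.submatrix f g).det := by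
  rw [Matrix.mul_assoc, det_mul_eq_sum]
  refine Finset.sum_congr rfl fun f _ => ?_
  have h : (X * E).submatrix f id = X.submatrix f id * E := rfl
  rw [h, det_mul_eq_sum', Finset.mul_sum]
  refine Finset.sum_congr rfl fun g _ => ?_
  rw [mul_assoc]
  rfl

/-- An injective map into `Fin m` is an order embedding up to reindexing of the source. -/
theorem exists_orderEmb_comp_equiv {κ : Type*} [Fintype κ] {k : ℕ} (hk : Fintype.card κ = k)
    {f : κ → Fin m} (hf : Function.Injective f) :
    ∃ (α : Fin k ↪o Fin m) (σ : κ ≃ Fin k), f = α ∘ σ := by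
  classical
  have hs : (Finset.univ.image f).card = k := by
    rw [Finset.card_image_of_injective _ hf, Finset.card_univ, hk]
  refine ⟨(Finset.univ.image f).orderEmbOfFin hs,
    (Equiv.ofBijective (fun a => (⟨f a, by simp⟩ : (Finset.univ.image f : Finset (Fin m))))
      ⟨fun a b h => hf (by simpa using h), ?_⟩).trans
      ((Finset.univ.image f).orderIsoOfFin hs).symm.toEquiv, ?_⟩
  · rintro ⟨y, hy⟩
    obtain ⟨a, -, rfl⟩ := Finset.mem_image.mp hy
    exact ⟨a, rfl⟩
  · ext a
    simp [← Finset.coe_orderIsoOfFin_apply]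
    rfl

theorem det_submatrix_mem_detIdeal {κ : Type*} [Fintype κ] [DecidableEq κ] {k : ℕ}
    (hk : Fintype.card κ = k) (A : Matrix (Fin m) (Fin n) R) (f : κ → Fin m) (g : κ → Fin n) :
    (A.submatrix f g).det ∈ detIdeal k A := by
  by_cases hf : Function.Injective f
  swap
  · simp only [Function.Injective, not_forall] at hf
    obtain ⟨a, b, h, hab⟩ := hf
    rw [det_zero_of_row_eq hab (by ext j; simp [h])]
    exact zero_mem _
  by_cases hg : Function.Injective g
  swap
  · simp only [Function.Injective, not_forall] at hg
    obtain ⟨a, b, h, hab⟩ := hg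
    rw [det_zero_of_column_eq hab (by intro j; simp [h])]
    exact zero_mem _
  obtain ⟨α, σ, rfl⟩ := exists_orderEmb_comp_equiv hk hf
  obtain ⟨β, τ, rfl⟩ := exists_orderEmb_comp_equiv hk hg
  have h : A.submatrix (α ∘ σ) (β ∘ τ) =
      ((A.submatrix α β).submatrix id (σ.symm.trans τ)).submatrix σ σ := by
    ext i j
    simp
  rw [h, det_submatrix_equiv_self, det_permute']
  exact Ideal.mul_mem_left _ _ (Ideal.subset_span ⟨(α, β), rfl⟩)

theorem det_mul_mul_mem_detIdeal {κ : Type*} [Fintype κ] [DecidableEq κ] {k : ℕ}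
    (hk : Fintype.card κ = k) (F : Matrix κ (Fin m) R) (A : Matrix (Fin m) (Fin n) R)
    (E : Matrix (Fin n) κ R) : (F * A * E).det ∈ detIdeal k A := by
  rw [det_mul_mul_eq_sum]
  exact sum_mem fun f _ => sum_mem fun g _ =>
    Ideal.mul_mem_left _ _ (det_submatrix_mem_detIdeal hk A f g)

theorem detIdeal_le_iff {k : ℕ} {A : Matrix (Fin m) (Fin n) R} {I : Ideal R} :
    detIdeal k A ≤ I ↔
      ∀ (α : Fin k ↪o Fin m) (β : Fin k ↪o Fin n), (A.submatrix α β).det ∈ I := by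
  rw [detIdeal, Ideal.span_le, Set.range_subset_iff, Prod.forall]
  rfl

theorem rankLE_iff {k : ℕ} {A : Matrix (Fin m) (Fin n) R} :
    RankLE A k ↔ detIdeal (k + 1) A = ⊥ := by
  rw [← le_bot_iff, detIdeal_le_iff]
  rfl

theorem hasRank_iff {k : ℕ} {A : Matrix (Fin m) (Fin n) R} :
    HasRank A k ↔ detIdeal k A = ⊤ ∧ RankLE A k := by
  rw [rankLE_iff, HasRank]

theorem detIdeal_map {S : Type*} [CommRing S] (φ : R →+* S) (k : ℕ)
    (A : Matrix (Fin m) (Fin n) R) : detIdeal k (A.map φ) = (detIdeal k A).map φ := by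
  rw [detIdeal, detIdeal, Ideal.map_span, ← Set.range_comp]
  congr 2
  ext p
  simp only [Function.comp_apply, RingHom.map_det]
  rfl

theorem detIdeal_eq_top_of_isUnit {k : ℕ} {A : Matrix (Fin m) (Fin n) R}
    {F : Matrix (Fin k) (Fin m) R} {E : Matrix (Fin n) (Fin k) R} (h : IsUnit (F * A * E).det) :
    detIdeal k A = ⊤ :=
  Ideal.eq_top_of_isUnit_mem _ (det_mul_mul_mem_detIdeal (by simp) F A E) h

/-- The product of matrices with inner dimension `k` has rank at most `k`. -/
theorem rankLE_mul {k : ℕ} (F : Matrix (Fin m) (Fin k) R) (E : Matrix (Fin k) (Fin n) R) :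
    RankLE (F * E) k := by
  intro α β
  have h : (F * E).submatrix α β = F.submatrix α id * E.submatrix id β := rfl
  rw [h, det_mul_eq_sum]
  refine Finset.sum_eq_zero fun f _ => ?_
  obtain ⟨a, b, hab, hf⟩ := Fintype.exists_ne_map_eq_of_card_lt f (by simp)
  rw [det_zero_of_row_eq hab (by ext j; simp [hf]), mul_zero]

/-- Generalized Cramer rule: the entries of the Schur complement of a `k × k` minor are, up to
that minor, determinants of order `k + 1`. -/
theorem det_mul_schur_mem_detIdeal {k : ℕ} (F : Matrix (Fin k) (Fin m) R)
    (A : Matrix (Fin m) (Fin n) R) (E : Matrix (Fin n) (Fin k) R) (i : Fin m) (j : Fin n) :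
    (F * A * E).det *
      ((F * A * E).det • A - A * (E * (F * A * E).adjugate * F) * A) i j ∈ detIdeal (k + 1) A := by
  set G := F * A * E with hG
  let e : Matrix Unit (Fin m) R := replicateRow Unit (Pi.single i 1)
  let e' : Matrix (Fin n) Unit R := replicateCol Unit (Pi.single j 1)
  let F' : Matrix (Fin k ⊕ Unit) (Fin m) R := fromRows F e
  let E' : Matrix (Fin n) (Fin k ⊕ Unit) R := fromCols E e'
  have hmem := det_mul_mul_mem_detIdeal (k := k + 1) (by simp) F' A E'
  have hB : F' * A * E' = fromBlocks G (F * A * e') (e * A * E) (e * A * e') := by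
    rw [fromRows_mul, fromRows_mul_fromCols]
  -- Column elimination in the bordered matrix, with the adjugate in place of the inverse, so that
  -- `G` need not be invertible; the price is the extra factor `G.det`.
  have hs : fromBlocks G (F * A * e') (e * A * E) (e * A * e') *
      fromBlocks 1 (-(G.adjugate * (F * A * e'))) 0 (G.det • 1) =
      fromBlocks G 0 (e * A * E) (e * (G.det • A - A * (E * G.adjugate * F) * A) * e') := by
    rw [fromBlocks_multiply]
    congr 1
    · simp
    · simp [← Matrix.mul_assoc, mul_adjugate]
    · simp
    · simp [← Matrix.mul_assoc, Matrix.mul_sub, Matrix.sub_mul]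
      abel
  have hd := congrArg det hs
  rw [det_mul, det_fromBlocks_zero₂₁, det_fromBlocks_zero₁₂, ← hB, det_one, one_mul] at hd
  have h1 : (G.det • (1 : Matrix Unit Unit R)).det = G.det := by simp
  have h2 : ∀ X : Matrix (Fin m) (Fin n) R, (e * X * e').det = X i j := by
    intro X
    simp [e, e', det_unique, Matrix.mul_apply, Pi.single_apply]
  rw [h1, h2] at hd
  rw [← hd]
  exact Ideal.mul_mem_right _ _ hmem

theorem RankLE.det_sq_smul {k : ℕ} {A : Matrix (Fin m) (Fin n) R} (h : RankLE A k)
    (F : Matrix (Fin k) (Fin m) R) (E : Matrix (Fin n) (Fin k) R) :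
    A * ((F * A * E).det • (E * (F * A * E).adjugate * F)) * A = ((F * A * E).det ^ 2) • A := by
  ext i j
  have := det_mul_schur_mem_detIdeal F A E i j
  rw [rankLE_iff.mp h, Ideal.mem_bot] at this
  simp only [Matrix.sub_apply, Matrix.smul_apply, smul_eq_mul, mul_sub] at this
  simp only [Matrix.mul_smul, Matrix.smul_mul, Matrix.smul_apply, smul_eq_mul, sq]
  linear_combination -this

theorem locallySimple_of_mul_mul_eq {A : Matrix (Fin m) (Fin n) R} {X : Matrix (Fin n) (Fin m) R}
    (h : A * X * A = A) : LocallySimple A := by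
  refine ⟨X * A * X, ?_, ?_⟩
  · calc A * (X * A * X) * A = A * X * A * X * A := by simp only [Matrix.mul_assoc]
      _ = A := by rw [h, h]
  · calc X * A * X * A * (X * A * X) = X * (A * X * A * X * A) * X := by
          simp only [Matrix.mul_assoc]
      _ = X * A * X := by rw [h, h]

theorem HasRank.locallySimple {k : ℕ} {A : Matrix (Fin m) (Fin n) R} (h : HasRank A k) :
    LocallySimple A := by
  -- The scalars `r` for which `A X A = r A` is solvable form an ideal. It contains the squares of
  -- the minors of order `k`, which still generate the unit ideal.
  let J : Ideal R :=
    { carrier := {r | ∃ X : Matrix (Fin n) (Fin m) R, A * X * A = r • A}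
      add_mem' := by
        rintro r s ⟨X, hX⟩ ⟨Y, hY⟩
        exact ⟨X + Y, by rw [Matrix.mul_add, Matrix.add_mul, hX, hY, add_smul]⟩
      zero_mem' := ⟨0, by simp⟩
      smul_mem' := by
        rintro c r ⟨X, hX⟩
        exact ⟨c • X, by rw [Matrix.mul_smul, Matrix.smul_mul, hX, smul_smul, smul_eq_mul]⟩ }
  have hJ : J = ⊤ := by
    rw [eq_top_iff, ← Ideal.span_pow_eq_top _ h.1 2, Ideal.span_le]
    rintro _ ⟨_, ⟨⟨α, β⟩, rfl⟩, rfl⟩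
    refine ⟨_, Eq.trans ((hasRank_iff.mp h).2.det_sq_smul
      ((1 : Matrix (Fin m) (Fin m) R).submatrix α id)
      ((1 : Matrix (Fin n) (Fin n) R).submatrix id β)) ?_⟩
    have : (1 : Matrix (Fin m) (Fin m) R).submatrix α id * A *
        (1 : Matrix (Fin n) (Fin n) R).submatrix id β =
        ((1 : Matrix (Fin m) (Fin m) R) * A * (1 : Matrix (Fin n) (Fin n) R)).submatrix α β := rfl
    rw [this, Matrix.one_mul, Matrix.mul_one]
  obtain ⟨X, hX⟩ := (Ideal.eq_top_iff_one J).mp hJ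
  exact locallySimple_of_mul_mul_eq (X := X) (by rw [hX, one_smul])

theorem locallySimpleOfRank_iff {k : ℕ} {A : Matrix (Fin m) (Fin n) R} :
    LocallySimpleOfRank A k ↔ HasRank A k :=
  ⟨fun h => h.2, fun h => ⟨h.locallySimple, h⟩⟩

/-- A matrix of rank at most `k` factors through `R^k` as soon as it has an invertible "generic"
minor of order `k`. -/
theorem RankLE.mul_inv_mul {k : ℕ} {A : Matrix (Fin m) (Fin n) R} (h : RankLE A k)
    {F : Matrix (Fin k) (Fin m) R} {E : Matrix (Fin n) (Fin k) R} (hG : IsUnit (F * A * E).det) :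
    A = A * E * ((F * A * E)⁻¹ * (F * A)) := by
  have := h.det_sq_smul F E
  rw [sq, mul_smul, Matrix.mul_smul, Matrix.smul_mul, hG.smul_left_cancel] at this
  refine hG.smul_left_cancel.mp (this.symm.trans ?_)
  rw [Matrix.inv_def, Matrix.smul_mul, Matrix.mul_smul, smul_smul,
    Ring.mul_inverse_cancel _ hG, one_smul]
  simp only [Matrix.mul_assoc]

end Minors

/-! ### The polynomial `det (I + Z W)`, Cayley-Hamilton and crossed matrices -/

section DetPoly

variable {R : Type*} [CommRing R] {m n : ℕ}

theorem detPoly_mul_comm (F : Matrix (Fin m) (Fin n) R) (H : Matrix (Fin n) (Fin m) R) :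
    detPoly (F * H) = detPoly (H * F) := by
  rw [detPoly, detPoly, Matrix.map_mul, Matrix.map_mul, ← Matrix.smul_mul, det_one_add_mul_comm,
    Matrix.mul_smul]

theorem detPoly_map {S : Type*} [CommRing S] (φ : R →+* S) (W : Matrix (Fin m) (Fin m) R) :
    detPoly (W.map φ) = (detPoly W).map φ := by
  rw [detPoly, detPoly, ← coe_mapRingHom, RingHom.map_det]
  congr 1
  ext i j : 2
  simp [Matrix.one_apply, apply_ite (Polynomial.map φ)]

theorem natDegree_detPoly_le (W : Matrix (Fin m) (Fin m) R) : (detPoly W).natDegree ≤ m := by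
  have := natDegree_det_X_add_C_le W 1
  rwa [Matrix.map_one C C_0 C_1, add_comm, Fintype.card_fin] at this

theorem coeff_detPoly_self (W : Matrix (Fin m) (Fin m) R) : (detPoly W).coeff m = W.det := by
  have := coeff_det_X_add_C_card W 1
  rwa [Matrix.map_one C C_0 C_1, add_comm, Fintype.card_fin] at this

theorem detPoly_smul_coeff (c : R) (W : Matrix (Fin m) (Fin m) R) (k : ℕ) :
    (detPoly (c • W)).coeff k = c ^ k * (detPoly W).coeff k := by
  rw [detPoly, detPoly, coeff_det_one_add_X_smul_eq_sum_minors,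
    coeff_det_one_add_X_smul_eq_sum_minors, Finset.mul_sum]
  refine Finset.sum_congr rfl fun s hs => ?_
  have : (c • W).submatrix (Subtype.val : s → Fin m) (Subtype.val : s → Fin m) =
    c • W.submatrix (Subtype.val : s → Fin m) (Subtype.val : s → Fin m) := rfl
  rw [this, det_smul, Fintype.card_coe, (Finset.mem_powersetCard.mp hs).2]

theorem coeff_detPoly_mul_mem_detIdeal (A : Matrix (Fin m) (Fin n) R)
    (A' : Matrix (Fin n) (Fin m) R) (k : ℕ) : (detPoly (A * A')).coeff k ∈ detIdeal k A := by
  rw [detPoly, coeff_det_one_add_X_smul_eq_sum_minors]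
  refine sum_mem fun s hs => ?_
  have h : (A * A').submatrix (Subtype.val : s → Fin m) (Subtype.val : s → Fin m) =
      ((1 : Matrix (Fin m) (Fin m) R) * A * A').submatrix Subtype.val Subtype.val := by
    rw [Matrix.one_mul]
  have h' : ((1 : Matrix (Fin m) (Fin m) R) * A * A').submatrix
      (Subtype.val : s → Fin m) (Subtype.val : s → Fin m) =
      (1 : Matrix (Fin m) (Fin m) R).submatrix Subtype.val id * A *
        A'.submatrix id Subtype.val := rfl
  rw [h, h']
  exact det_mul_mul_mem_detIdeal (by simp [(Finset.mem_powersetCard.mp hs).2]) _ _ _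

/-- The Cayley-Hamilton theorem, in terms of the coefficients of `det (I + Z W)`. -/
theorem sum_coeff_detPoly_smul_pow (W : Matrix (Fin m) (Fin m) R) :
    ∑ l ∈ Finset.range (m + 1), (detPoly W).coeff l • (-W) ^ (m - l) = 0 := by
  nontriviality R
  have hrev : (-W).charpoly.reverse = detPoly W := by
    rw [reverse_charpoly, charpolyRev, detPoly]
    congr 1
    ext i j : 2
    simp
  have hd : (-W).charpoly.natDegree = m := by simp
  have hCH := aeval_self_charpoly (-W)
  rw [aeval_eq_sum_range, hd, ← Finset.sum_range_reflect] at hCH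
  rw [← hCH]
  refine Finset.sum_congr rfl fun l hl => ?_
  have hl' : l ≤ m := by simpa [Nat.lt_succ_iff] using hl
  rw [← hrev, coeff_reverse, hd, revAt_le hl', Nat.add_sub_cancel]

/-- The defect is the Cayley-Hamilton expression truncated at order `k`; the equation for `genAdj`
thus says that this expression kills `A`. -/
theorem mul_genAdj (k : ℕ) (A : Matrix (Fin m) (Fin n) R) (A' : Matrix (Fin n) (Fin m) R) :
    A * genAdj k A A' = (detPoly (A * A')).coeff k • 1 -
      ∑ l ∈ Finset.range (k + 1), (detPoly (A * A')).coeff l • (-(A * A')) ^ (k - l) := by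
  have hpow : ∀ i : ℕ, A * ((A' * A) ^ i * A') = (A * A') ^ (i + 1) := by
    intro i
    induction i with
    | zero => simp
    | succ i ih =>
      rw [pow_succ' (A * A'), ← ih, pow_succ']
      simp only [Matrix.mul_assoc]
  rw [Finset.sum_range_succ, Nat.sub_self, pow_zero, sub_add_cancel_right, genAdj, Matrix.mul_sum,
    ← Finset.sum_range_reflect, ← Finset.sum_neg_distrib]
  refine Finset.sum_congr rfl fun l hl => ?_
  have hl' : l < k := Finset.mem_range.mp hl
  have h1 : k - 1 - (k - 1 - l) = l := by omega
  have h2 : k - l = k - 1 - l + 1 := by omega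
  have h3 : -(A * A') = (-1 : R) • (A * A') := by simp
  rw [Matrix.mul_smul, hpow, h1, h2, h3, _root_.smul_pow, smul_smul, ← neg_smul]
  congr 1
  ring

/-- The Cayley-Hamilton identity of order `k` for a matrix factoring through `R^k`. -/
theorem sum_coeff_detPoly_smul_pow_mul {k : ℕ} (F : Matrix (Fin m) (Fin k) R)
    (H : Matrix (Fin k) (Fin m) R) :
    (∑ l ∈ Finset.range (k + 1), (detPoly (F * H)).coeff l • (-(F * H)) ^ (k - l)) * F = 0 := by
  have hpow : ∀ i : ℕ, (-(F * H)) ^ i * F = F * (-(H * F)) ^ i := by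
    intro i
    induction i with
    | zero => simp
    | succ i ih =>
      rw [pow_succ', Matrix.mul_assoc, ih, pow_succ']
      simp only [← Matrix.mul_assoc, Matrix.neg_mul, Matrix.mul_neg]
  have := congrArg (F * ·) (sum_coeff_detPoly_smul_pow (H * F))
  simp only [Matrix.mul_zero] at this
  rw [← this, Matrix.sum_mul, Matrix.mul_sum]
  refine Finset.sum_congr rfl fun l _ => ?_
  rw [Matrix.smul_mul, hpow, Matrix.mul_smul, detPoly_mul_comm]

theorem mul_genAdj_mul_of_factor {k : ℕ} (F : Matrix (Fin m) (Fin k) R)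
    (E : Matrix (Fin k) (Fin n) R) (A' : Matrix (Fin n) (Fin m) R) :
    F * E * genAdj k (F * E) A' * (F * E) = (detPoly (F * E * A')).coeff k • (F * E) := by
  rw [mul_genAdj, Matrix.sub_mul, Matrix.smul_mul, Matrix.one_mul, sub_eq_self, Matrix.mul_assoc F,
    ← Matrix.mul_assoc _ F E, sum_coeff_detPoly_smul_pow_mul, Matrix.zero_mul]

/-- `genAdj` is `A'` times a polynomial in `A A'`. -/
theorem genAdj_eq_mul (k : ℕ) (A : Matrix (Fin m) (Fin n) R) (A' : Matrix (Fin n) (Fin m) R) :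
    ∃ Y : Matrix (Fin m) (Fin m) R, genAdj k A A' = A' * Y := by
  have hpow : ∀ i : ℕ, (A' * A) ^ i * A' = A' * (A * A') ^ i := by
    intro i
    induction i with
    | zero => simp
    | succ i ih =>
      rw [pow_succ', Matrix.mul_assoc, ih, pow_succ']
      simp only [← Matrix.mul_assoc]
  refine ⟨∑ i ∈ Finset.range k,
    ((-1) ^ i * (detPoly (A * A')).coeff (k - 1 - i)) • (A * A') ^ i, ?_⟩
  rw [genAdj, Matrix.mul_sum]
  simp only [hpow, Matrix.mul_smul]

theorem genAdj_eq_mul' (k : ℕ) (A : Matrix (Fin m) (Fin n) R) (A' : Matrix (Fin n) (Fin m) R) :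
    ∃ Y : Matrix (Fin n) (Fin n) R, genAdj k A A' = Y * A' := by
  refine ⟨∑ i ∈ Finset.range k,
    ((-1) ^ i * (detPoly (A * A')).coeff (k - 1 - i)) • (A' * A) ^ i, ?_⟩
  rw [genAdj, Matrix.sum_mul]
  simp only [Matrix.smul_mul]

theorem col_mul {p : ℕ} (A : Matrix (Fin m) (Fin n) R) (Y : Matrix (Fin n) (Fin p) R) (j : Fin p) :
    (A * Y).col j = A *ᵥ Y.col j := rfl

theorem Crossed.symm {A : Matrix (Fin m) (Fin n) R} {A' : Matrix (Fin n) (Fin m) R}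
    (h : Crossed A A') : Crossed A' A :=
  ⟨h.2.symm, h.1.symm⟩

/-- Column by column: `A'` is injective on `Im A` because `Im A` meets `Ker A'` trivially. -/
theorem Crossed.mul_eq_zero_of_mul_mul {A : Matrix (Fin m) (Fin n) R}
    {A' : Matrix (Fin n) (Fin m) R} (h : Crossed A A') {p : ℕ} {Y : Matrix (Fin n) (Fin p) R}
    (hY : A' * (A * Y) = 0) : A * Y = 0 := by
  ext i j
  have hmem : (A * Y).col j ∈ im A := ⟨Y.col j, rfl⟩
  have hker : (A * Y).col j ∈ ker A' := by
    rw [ker, LinearMap.mem_ker, mulVecLin_apply, ← col_mul, hY]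
    rfl
  exact congrFun (Submodule.disjoint_def.mp h.1.disjoint _ hmem hker) i

theorem Crossed.mul_eq_zero {A : Matrix (Fin m) (Fin n) R}
    {A' : Matrix (Fin n) (Fin m) R} (h : Crossed A A') {p : ℕ} {Y : Matrix (Fin n) (Fin p) R}
    (hY : A * A' * (A * Y) = 0) : A * Y = 0 :=
  h.mul_eq_zero_of_mul_mul (h.symm.mul_eq_zero_of_mul_mul (by rw [← Matrix.mul_assoc, hY]))

theorem Crossed.mul_eq_zero_of_pow_mul {A : Matrix (Fin m) (Fin n) R}
    {A' : Matrix (Fin n) (Fin m) R} (h : Crossed A A') (j : ℕ) {p : ℕ} {Y : Matrix (Fin n) (Fin p) R}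
    (hY : (A * A') ^ j * (A * Y) = 0) : A * Y = 0 := by
  induction j generalizing Y with
  | zero => simpa using hY
  | succ j ih =>
    refine h.mul_eq_zero ?_
    rw [Matrix.mul_assoc]
    apply ih
    rw [pow_succ] at hY
    simpa only [Matrix.mul_assoc] using hY

theorem Crossed.mul_genAdj_mul {k : ℕ} {A : Matrix (Fin m) (Fin n) R}
    {A' : Matrix (Fin n) (Fin m) R} (h : Crossed A A') (hk : k ≤ m)
    (hdeg : (detPoly (A * A')).natDegree ≤ k) :
    A * genAdj k A A' * A = (detPoly (A * A')).coeff k • A := by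
  -- The degree bound removes the terms `l > k` of Cayley-Hamilton in size `m`; the remaining ones
  -- share the factor `(-(A A')) ^ (m - k)`, which can be cancelled on `Im A`.
  have hCH : (-(A * A')) ^ (m - k) *
      ∑ l ∈ Finset.range (k + 1), (detPoly (A * A')).coeff l • (-(A * A')) ^ (k - l) = 0 := by
    rw [← sum_coeff_detPoly_smul_pow (A * A'), Matrix.mul_sum]
    refine Eq.trans ?_ (Finset.sum_subset (s₁ := Finset.range (k + 1))
      (by simpa using hk) fun l _ hl => ?_)
    · refine Finset.sum_congr rfl fun l hl => ?_
      have hl' : l ≤ k := by simpa [Nat.lt_succ_iff] using hl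
      rw [Matrix.mul_smul, ← pow_add]
      congr 2
      omega
    · rw [coeff_eq_zero_of_natDegree_lt (by simp at hl; omega), zero_smul]
  have hA : A * ((detPoly (A * A')).coeff k • 1 - genAdj k A A' * A) =
      (∑ l ∈ Finset.range (k + 1), (detPoly (A * A')).coeff l • (-(A * A')) ^ (k - l)) * A := by
    rw [Matrix.mul_sub, ← Matrix.mul_assoc, mul_genAdj, Matrix.sub_mul, Matrix.mul_smul,
      Matrix.mul_one, Matrix.smul_mul, Matrix.one_mul, sub_sub_cancel]
  have h0 : (A * A') ^ (m - k) * (A * ((detPoly (A * A')).coeff k • 1 - genAdj k A A' * A)) = 0 := by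
    have h3 : -(A * A') = (-1 : R) • (A * A') := by simp
    rw [h3, _root_.smul_pow, Matrix.smul_mul,
      ((isUnit_neg_one (α := R)).pow _).smul_eq_zero, ← h3] at hCH
    rw [hA, ← Matrix.mul_assoc, hCH, Matrix.zero_mul]
  have := h.mul_eq_zero_of_pow_mul _ h0
  rw [Matrix.mul_sub, Matrix.mul_smul, Matrix.mul_one, sub_eq_zero, ← Matrix.mul_assoc] at this
  exact this.symm

end DetPoly

/-! ### Gram coefficients with denominators cleared -/

section GramNum

variable {R : Type*} [CommRing R] {m n : ℕ}

/-- Gram determinants with weights: over a domain, the quadratic form with generic diagonal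
`X ^ w i` is nondegenerate on every direct summand defined over the constants. -/
theorem det_transpose_mul_diagonal_mul_ne_zero {K ι κ : Type*} [CommRing K] [IsDomain K]
    [Fintype ι] [DecidableEq ι] [Fintype κ] [DecidableEq κ] {F : Matrix ι κ K} {L : Matrix κ ι K}
    (hL : L * F = 1) {w : ι → ℕ} (hw : Function.Injective w) :
    ((F.map C)ᵀ * diagonal (fun i => (X : K[X]) ^ w i) * F.map C).det ≠ 0 := by
  intro hdet
  obtain ⟨v, hv, hv0⟩ := exists_mulVec_eq_zero_iff.mpr hdet
  set y : ι → K[X] := F.map C *ᵥ v with hy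
  have hy0 : y ≠ 0 := by
    intro h
    apply hv
    have : L.map C *ᵥ y = v := by
      rw [hy, mulVec_mulVec, ← Matrix.map_mul, hL, Matrix.map_one C C_0 C_1, one_mulVec]
    rw [← this, h, mulVec_zero]
  classical
  obtain ⟨i₀, hi₀, hmax⟩ := Finset.exists_max_image (Finset.univ.filter fun i => y i ≠ 0)
    (fun i => (y i).natDegree) (by
      obtain ⟨i, hi⟩ := Function.ne_iff.mp hy0
      exact ⟨i, by simpa using hi⟩)
  set d := (y i₀).natDegree with hd
  have hdeg : ∀ i, (y i).natDegree ≤ d := by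
    intro i
    by_cases hi : y i = 0
    · simp [hi]
    · exact hmax i (by simpa using hi)
  have hc₀ : (y i₀).coeff d ≠ 0 := leadingCoeff_ne_zero.mpr (by simpa using hi₀)
  obtain ⟨i₁, hi₁, hmax₁⟩ := Finset.exists_max_image
    (Finset.univ.filter fun i => (y i).coeff d ≠ 0) w ⟨i₀, by simpa using hc₀⟩
  -- Since `F` is constant, it commutes with taking coefficients of degree `d`. Pairing the kernel
  -- relation with this constant vector instead of `v` makes the coefficient of degree `w i₁ + d`
  -- equal to the square of the coefficient of degree `d` of `y i₁`.
  have hc : F.map C *ᵥ (fun a => C ((v a).coeff d)) = fun i => C ((y i).coeff d) := by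
    ext1 i
    simp [hy, Matrix.mulVec, dotProduct, finsetSum_coeff]
  have hsum : ∑ i, C ((y i).coeff d) * (X ^ w i * y i) = 0 := by
    have h := congrArg (fun u => (fun a => C ((v a).coeff d)) ⬝ᵥ u) hv0
    simp only [dotProduct_zero] at h
    rw [← mulVec_mulVec, ← mulVec_mulVec, dotProduct_mulVec, vecMul_transpose, hc, ← hy] at h
    simpa [dotProduct, mulVec_diagonal] using h
  have hcoeff := congrArg (fun p => p.coeff (w i₁ + d)) hsum
  simp only [finsetSum_coeff, coeff_C_mul, coeff_zero] at hcoeff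
  rw [Finset.sum_eq_single i₁, coeff_X_pow_mul', if_pos (by omega), Nat.add_sub_cancel_left] at hcoeff
  · exact (by simpa using hi₁ : (y i₁).coeff d ≠ 0) (mul_self_eq_zero.mp hcoeff)
  · intro i _ hne
    by_cases hi : (y i).coeff d = 0
    · rw [hi, zero_mul]
    · have hle := hmax₁ i (by simpa using hi)
      have hlt : w i < w i₁ := lt_of_le_of_ne hle fun h => hne (hw h)
      have h0 : (y i).coeff (w i₁ + d - w i) = 0 :=
        coeff_eq_zero_of_natDegree_lt ((hdeg i).trans_lt (by omega))
      rw [coeff_X_pow_mul', if_pos (by omega), h0, mul_zero]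
  · simp

/-- The polynomial `t^{nk} g_k(t)`. -/
noncomputable def gramNum (A : Matrix (Fin m) (Fin n) R) (k : ℕ) : R[X] :=
  (detPoly (A.map C * diagonal (fun j : Fin n => (X : R[X]) ^ (n - (j : ℕ))) * (A.map C)ᵀ *
    diagonal (fun i : Fin m => (X : R[X]) ^ (i : ℕ)))).coeff k

theorem gramNum_map {S : Type*} [CommRing S] (φ : R →+* S) (A : Matrix (Fin m) (Fin n) R) (k : ℕ) :
    gramNum (A.map φ) k = (gramNum A k).map φ := by
  rw [gramNum, gramNum, ← coe_mapRingHom, ← coeff_map, ← detPoly_map]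
  congr 2
  rw [Matrix.map_mul, Matrix.map_mul, Matrix.map_mul, diagonal_map (map_zero _),
    diagonal_map (map_zero _), transpose_map]
  simp only [map_pow, coe_mapRingHom, map_X]
  have h : (A.map φ).map C = (A.map C).map (mapRingHom φ) := by
    ext i j : 2
    simp
  rw [h]
  rfl

/-- Distinct values bound the two sums below by `1 + ⋯ + k` and `0 + ⋯ + (k - 1)`, which add up to
`k²`. -/
theorem card_mul_card_le_sum {κ : Type*} [Fintype κ] {f g : κ → ℤ} (hf : Function.Injective f)
    (hg : Function.Injective g) (hf0 : ∀ a, 1 ≤ f a) (hg0 : ∀ a, 0 ≤ g a) :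
    (Fintype.card κ : ℤ) * Fintype.card κ ≤ ∑ a, (f a + g a) := by
  classical
  have h1 := Finset.sum_range_le_sum (s := Finset.univ.image f) (c := 1) (by simpa using hf0)
  have h2 := Finset.sum_range_le_sum (s := Finset.univ.image g) (c := 0) (by simpa using hg0)
  rw [Finset.sum_image hf.injOn, Finset.card_image_of_injective _ hf, Finset.card_univ] at h1
  rw [Finset.sum_image hg.injOn, Finset.card_image_of_injective _ hg, Finset.card_univ] at h2
  have h3 : ∀ k : ℕ, ∑ r ∈ Finset.range k, (1 + (r : ℤ)) + ∑ r ∈ Finset.range k, (0 + (r : ℤ)) =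
      (k : ℤ) * k := by
    intro k
    induction k with
    | zero => simp
    | succ k ih =>
      rw [Finset.sum_range_succ, Finset.sum_range_succ]
      push_cast
      linear_combination ih
  rw [Finset.sum_add_distrib, ← h3]
  exact add_le_add h1 h2

/-- Each nonzero term of the expansion carries `k` distinct exponents `n - j ≥ 1` and `k` distinct
exponents `i ≥ 0`. This is why `t^{k(n-k)} g_k` is a polynomial. -/
theorem X_pow_dvd_gramNum (A : Matrix (Fin m) (Fin n) R) (k : ℕ) :
    (X : R[X]) ^ (k * k) ∣ gramNum A k := by
  rw [gramNum, detPoly, coeff_det_one_add_X_smul_eq_sum_minors]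
  refine Finset.dvd_sum fun s hs => ?_
  have hk : Fintype.card s = k := by simp [(Finset.mem_powersetCard.mp hs).2]
  rw [Matrix.mul_assoc]
  have h : ∀ (P : Matrix (Fin m) (Fin n) R[X]) (Q : Matrix (Fin n) (Fin m) R[X]),
      (P * Q).submatrix (Subtype.val : s → Fin m) (Subtype.val : s → Fin m) =
      P.submatrix Subtype.val id * Q.submatrix id Subtype.val := fun _ _ => rfl
  rw [h, det_mul_eq_sum]
  refine Finset.dvd_sum fun g _ => ?_
  by_cases hg : Function.Injective g
  swap
  · simp only [Function.Injective, not_forall] at hg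
    obtain ⟨a, b, h, hab⟩ := hg
    rw [det_zero_of_row_eq hab (by ext1 j; simp [h]), mul_zero]
    exact dvd_zero _
  have h1 : (((A.map C)ᵀ * diagonal (fun i : Fin m => (X : R[X]) ^ (i : ℕ))).submatrix id
      Subtype.val).submatrix g id = ((A.map C)ᵀ.submatrix g (Subtype.val : s → Fin m)) *
        diagonal (fun i : s => (X : R[X]) ^ ((i : Fin m) : ℕ)) := by
    ext1 i j
    simp [mul_diagonal]
  have hle := card_mul_card_le_sum (f := fun a : s => ((n - (g a : ℕ) : ℕ) : ℤ))
    (g := fun a : s => (((a : Fin m) : ℕ) : ℤ))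
    (fun a b hab => hg (Fin.ext (by have := (g a).2; have := (g b).2; simp at hab; omega)))
    (fun a b hab => Subtype.ext (Fin.ext (by simpa using hab)))
    (fun a => by have := (g a).2; omega) (fun a => by positivity)
  rw [hk, Finset.sum_add_distrib] at hle
  have hle' : k * k ≤ ∑ a : s, (n - (g a : ℕ)) + ∑ a : s, ((a : Fin m) : ℕ) := by exact_mod_cast hle
  rw [h1, det_mul, det_diagonal, Finset.prod_pow_eq_pow_sum]
  simp only [submatrix_apply, mul_diagonal, Matrix.map_apply, id, Finset.prod_mul_distrib,
    Finset.prod_pow_eq_pow_sum]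
  refine (pow_dvd_pow X hle').trans ?_
  rw [pow_add]
  exact mul_dvd_mul (Dvd.intro_left _ rfl) (Dvd.intro_left _ rfl)

/-- With `A = F E`, `F` left invertible and `E` right invertible, the Gram coefficient splits into
two weighted Gram determinants, both nonzero. -/
theorem gramNum_ne_zero {K : Type*} [Field K] {k : ℕ} {A : Matrix (Fin m) (Fin n) K}
    (h : RankLE A k) {α : Fin k → Fin m} {β : Fin k → Fin n} (hd : (A.submatrix α β).det ≠ 0) :
    gramNum A k ≠ 0 := by
  set F₀ := (1 : Matrix (Fin m) (Fin m) K).submatrix α id with hF₀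
  set E₀ := (1 : Matrix (Fin n) (Fin n) K).submatrix id β with hE₀
  have hG : IsUnit (F₀ * A * E₀).det := by
    have : F₀ * A * E₀ =
      ((1 : Matrix (Fin m) (Fin m) K) * A * (1 : Matrix (Fin n) (Fin n) K)).submatrix α β := rfl
    rw [this, Matrix.one_mul, Matrix.mul_one]
    exact hd.isUnit
  set G := F₀ * A * E₀ with hG'
  have hA := h.mul_inv_mul hG
  set F := A * E₀ with hF
  set E := G⁻¹ * (F₀ * A) with hE
  have hLF : (G⁻¹ * F₀) * F = 1 := by
    rw [hF, Matrix.mul_assoc, ← Matrix.mul_assoc F₀, nonsing_inv_mul _ hG]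
  have hES : E₀ᵀ * Eᵀ = 1 := by
    rw [← transpose_mul, hE, Matrix.mul_assoc, ← hG', nonsing_inv_mul _ hG, transpose_one]
  have h1 := det_transpose_mul_diagonal_mul_ne_zero hLF (w := fun i : Fin m => (i : ℕ))
    Fin.val_injective
  have h2 := det_transpose_mul_diagonal_mul_ne_zero hES (w := fun j : Fin n => n - (j : ℕ))
    (fun a b hab => Fin.ext (by have := a.2; have := b.2; simp at hab; omega))
  rw [gramNum, hA, Matrix.map_mul, transpose_mul]
  have h3 : ∀ (D : Matrix (Fin n) (Fin n) K[X]) (D' : Matrix (Fin m) (Fin m) K[X]),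
      F.map C * E.map C * D * ((E.map C)ᵀ * (F.map C)ᵀ) * D' =
      F.map C * (E.map C * D * (E.map C)ᵀ * (F.map C)ᵀ * D') := by
    intro D D'
    simp only [Matrix.mul_assoc]
  have h4 : ∀ (D : Matrix (Fin n) (Fin n) K[X]) (D' : Matrix (Fin m) (Fin m) K[X]),
      E.map C * D * (E.map C)ᵀ * (F.map C)ᵀ * D' * F.map C =
      (E.map C * D * (E.map C)ᵀ) * ((F.map C)ᵀ * D' * F.map C) := by
    intro D D'
    simp only [Matrix.mul_assoc]
  rw [h3, detPoly_mul_comm, coeff_detPoly_self, h4, det_mul]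
  exact mul_ne_zero h2 h1

/-- The Gram coefficients of a matrix of rank `k` generate the unit ideal. -/
theorem HasRank.contentIdeal_gramNum {k : ℕ} {A : Matrix (Fin m) (Fin n) R} (h : HasRank A k) :
    (gramNum A k).contentIdeal = ⊤ := by
  by_contra hne
  obtain ⟨P, hP, hle⟩ := Ideal.exists_le_maximal _ hne
  let _ := Ideal.Quotient.field P
  have h0 : gramNum (A.map (Ideal.Quotient.mk P)) k = 0 := by
    rw [gramNum_map]
    ext i
    rw [coeff_map, coeff_zero, Ideal.Quotient.eq_zero_iff_mem]
    exact hle (coeff_mem_contentIdeal _ _)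
  have htop : detIdeal k (A.map (Ideal.Quotient.mk P)) = ⊤ := by
    rw [detIdeal_map, h.1, Ideal.map_top]
  have hrk : RankLE (A.map (Ideal.Quotient.mk P)) k := by
    rw [rankLE_iff, detIdeal_map, h.2, Ideal.map_bot]
  have hbot : detIdeal k (A.map (Ideal.Quotient.mk P)) ≤ ⊥ := by
    rw [detIdeal_le_iff]
    intro α β
    by_contra hd
    exact gramNum_ne_zero hrk hd h0
  rw [htop] at hbot
  exact bot_ne_top (le_antisymm hbot le_top).symm

/-- If the Gram coefficients of order greater than `k` vanish, the minors of order `k + 1` are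
nilpotent. -/
theorem detIdeal_le_nilradical {k : ℕ} {A : Matrix (Fin m) (Fin n) R}
    (h : ∀ l, k < l → gramNum A l = 0) : detIdeal (k + 1) A ≤ nilradical R := by
  rw [nilradical_eq_sInf]
  refine le_sInf fun P (hP : P.IsPrime) => ?_
  let K := FractionRing (R ⧸ P)
  let φ : R →+* K := (algebraMap (R ⧸ P) K).comp (Ideal.Quotient.mk P)
  have hφ : ∀ r, φ r = 0 → r ∈ P := by
    intro r hr
    rw [← Ideal.Quotient.eq_zero_iff_mem]
    exact (IsFractionRing.injective (R ⧸ P) K) (by rw [map_zero]; exact hr)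
  rw [detIdeal_le_iff]
  intro α β
  by_contra hnot
  -- For the largest order `r` of a nonzero minor over `K`, the rank is exactly `r > k`, so the Gram
  -- coefficient of order `r` cannot vanish.
  let p : ℕ → Prop := fun r => k < r ∧ ∃ (α : Fin r ↪o Fin m) (β : Fin r ↪o Fin n),
    ((A.map φ).submatrix α β).det ≠ 0
  have hp : p (k + 1) := by
    refine ⟨Nat.lt_succ_self k, α, β, fun h0 => hnot (hφ _ ?_)⟩
    rw [RingHom.map_det]
    exact h0
  have hbd : ∀ r, p r → r ≤ m := by
    rintro r ⟨-, α, -⟩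
    simpa using Fintype.card_le_of_injective α α.injective
  classical
  have hr := Nat.findGreatest_spec (hbd _ hp) hp
  set r := Nat.findGreatest p m with hrdef
  obtain ⟨hkr, α', β', hd⟩ := hr
  refine gramNum_ne_zero (k := r) ?_ hd (by rw [gramNum_map, h r hkr, Polynomial.map_zero])
  intro α'' β''
  by_contra hd'
  have hp' : p (r + 1) := ⟨hkr.trans (Nat.lt_succ_self r), α'', β'', hd'⟩
  have := Nat.le_findGreatest (hbd (r + 1) hp') hp'
  omega

end GramNum

/-! ### Transfer between `R` and `R(t)` -/

section NagataRing

variable {R : Type*} [CommRing R] {m n : ℕ}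

/-- By McCoy's theorem only constant annihilators matter, and a constant killing a primitive
polynomial kills `1`. -/
theorem primitiveSubmonoid_le_nonZeroDivisors : primitiveSubmonoid R ≤ nonZeroDivisors R[X] := by
  intro p hp
  rw [Polynomial.mem_nonZeroDivisors_iff]
  intro a ha
  have hp : p.contentIdeal = ⊤ := hp
  have hle : p.contentIdeal ≤ LinearMap.ker (LinearMap.mulLeft R a) := by
    rw [contentIdeal_def, Ideal.span_le]
    intro c hc
    obtain ⟨i, -, rfl⟩ := mem_coeffs_iff.mp hc
    have := congrArg (fun q => q.coeff i) ha
    simpa using this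
  rw [hp] at hle
  simpa using hle (show (1 : R) ∈ ⊤ from trivial)

theorem algebraMap_polynomial_injective :
    Function.Injective (algebraMap R[X] (Nagata R)) :=
  IsLocalization.injective _ primitiveSubmonoid_le_nonZeroDivisors

theorem algebraMap_nagata_eq (r : R) :
    algebraMap R (Nagata R) r = algebraMap R[X] (Nagata R) (C r) :=
  IsScalarTower.algebraMap_apply R R[X] (Nagata R) r

theorem algebraMap_nagata_injective : Function.Injective (algebraMap R (Nagata R)) := by
  intro r s h
  rw [algebraMap_nagata_eq, algebraMap_nagata_eq] at h
  exact C_injective (algebraMap_polynomial_injective h)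

theorem isUnit_algebraMap_of_contentIdeal {p : R[X]} (hp : p.contentIdeal = ⊤) :
    IsUnit (algebraMap R[X] (Nagata R) p) :=
  IsLocalization.map_units (Nagata R) (⟨p, hp⟩ : primitiveSubmonoid R)

/-- If `I` generates the unit ideal, some primitive polynomial has all its coefficients in `I`. -/
theorem ideal_eq_top_of_map_nagata {I : Ideal R} (h : I.map (algebraMap R (Nagata R)) = ⊤) :
    I = ⊤ := by
  rw [IsScalarTower.algebraMap_eq R R[X] (Nagata R), ← Ideal.map_map] at h
  by_contra hI
  refine (IsLocalization.map_algebraMap_ne_top_iff_disjoint (primitiveSubmonoid R) (Nagata R)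
    (I.map (algebraMap R R[X]))).mpr ?_ h
  rw [Set.disjoint_left]
  intro p hp hpI
  have hp : p.contentIdeal = ⊤ := hp
  apply hI
  rw [eq_top_iff, ← hp, contentIdeal_def, Ideal.span_le]
  intro c hc
  obtain ⟨i, -, rfl⟩ := mem_coeffs_iff.mp hc
  exact Ideal.mem_map_C_iff.mp hpI i

theorem hasRank_overNagata_iff {A : Matrix (Fin m) (Fin n) R} {k : ℕ} :
    HasRank (overNagata A) k ↔ HasRank A k := by
  rw [HasRank, HasRank, overNagata, detIdeal_map, detIdeal_map]
  refine and_congr ⟨ideal_eq_top_of_map_nagata, fun h => by rw [h, Ideal.map_top]⟩ ?_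
  exact Ideal.map_eq_bot_iff_of_injective algebraMap_nagata_injective

theorem coe_tUnit : (tUnit R : Nagata R) = algebraMap R[X] (Nagata R) X := rfl

theorem inv_Q : (Q R n)⁻¹ = 
    diagonal fun j : Fin n => (((tUnit R)⁻¹ ^ (j : ℕ) : (Nagata R)ˣ) : Nagata R) := by
  refine inv_eq_right_inv ?_
  rw [Q, diagonal_mul_diagonal, ← diagonal_one]
  congr 1
  ext1 j
  simp [← mul_pow]

theorem overNagata_eq (A : Matrix (Fin m) (Fin n) R) :
    overNagata A = (A.map C).map (algebraMap R[X] (Nagata R)) := by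
  ext1 i j
  exact algebraMap_nagata_eq _

theorem algebraMap_gramNum (A : Matrix (Fin m) (Fin n) R) (k : ℕ) :
    algebraMap R[X] (Nagata R) (gramNum A k) = ((tUnit R : Nagata R) ^ n) ^ k * gram A k := by
  have hD : (diagonal fun j : Fin n => (tUnit R : Nagata R) ^ (n - (j : ℕ))) =
      (tUnit R : Nagata R) ^ n • (Q R n)⁻¹ := by
    rw [inv_Q, ← diagonal_smul]
    congr 1
    ext1 j
    simp only [Pi.smul_apply, smul_eq_mul, ← Units.val_pow_eq_pow_val, ← Units.val_mul]
    rw [inv_pow, pow_sub _ j.2.le]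
  rw [gramNum, gram, gramPoly, ← detPoly_smul_coeff, ← coeff_map, ← detPoly_map]
  congr 2
  rw [Matrix.map_mul, Matrix.map_mul, Matrix.map_mul, diagonal_map (map_zero _),
    diagonal_map (map_zero _), ← transpose_map, ← overNagata_eq, circ]
  simp only [map_pow, ← coe_tUnit]
  rw [hD, Matrix.mul_smul, Matrix.smul_mul, Matrix.smul_mul]
  simp only [Matrix.mul_assoc]
  rfl

theorem gram_eq_zero_iff (A : Matrix (Fin m) (Fin n) R) (k : ℕ) :
    gram A k = 0 ↔ gramNum A k = 0 := by
  rw [← map_eq_zero_iff _ (algebraMap_polynomial_injective (R := R)), algebraMap_gramNum,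
    (((tUnit R).isUnit.pow n).pow k).mul_right_eq_zero]

theorem gramPrimitive_of_contentIdeal {A : Matrix (Fin m) (Fin n) R} {k : ℕ}
    (h : (gramNum A k).contentIdeal = ⊤) : GramPrimitive A k := by
  obtain ⟨p, hp⟩ := X_pow_dvd_gramNum A k
  refine ⟨p, ?_, ?_⟩
  · rw [eq_top_iff, ← h]
    exact contentIdeal_le_contentIdeal_of_dvd (Dvd.intro_left _ hp.symm)
  · have h1 := algebraMap_gramNum A k
    rw [hp, map_mul, map_pow, ← coe_tUnit] at h1
    -- The exponents match: `k² + k(n - k) = nk`, also as integers when `k > n`.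
    have h2 : (tUnit R : Nagata R) ^ (k * k) *
        ((tUnit R ^ ((k : ℤ) * ((n : ℤ) - (k : ℤ))) : (Nagata R)ˣ) : Nagata R) =
        ((tUnit R : Nagata R) ^ n) ^ k := by
      rw [← pow_mul, ← Units.val_pow_eq_pow_val, ← Units.val_pow_eq_pow_val, ← Units.val_mul,
        ← zpow_natCast, ← zpow_natCast, ← _root_.zpow_add]
      congr 2
      push_cast
      ring
    rw [← h2, mul_assoc] at h1
    exact ((tUnit R).isUnit.pow (k * k)).mul_left_cancel h1

theorem GramPrimitive.isUnit_gram {A : Matrix (Fin m) (Fin n) R} {k : ℕ}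
    (h : GramPrimitive A k) : IsUnit (gram A k) := by
  obtain ⟨p, hp, h⟩ := h
  have := isUnit_algebraMap_of_contentIdeal hp
  rw [h] at this
  exact isUnit_of_mul_isUnit_right this

theorem GramPrimitive.detIdeal_eq_top {A : Matrix (Fin m) (Fin n) R} {k : ℕ}
    (h : GramPrimitive A k) : detIdeal k A = ⊤ := by
  apply ideal_eq_top_of_map_nagata
  rw [← detIdeal_map]
  exact Ideal.eq_top_of_isUnit_mem _ (coeff_detPoly_mul_mem_detIdeal _ _ _) h.isUnit_gram

theorem detIdeal_le_nilradical_of_natDegree_gramPoly {A : Matrix (Fin m) (Fin n) R} {k : ℕ}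
    (h : (gramPoly A).natDegree ≤ k) : detIdeal (k + 1) A ≤ nilradical R :=
  detIdeal_le_nilradical fun l hl =>
    (gram_eq_zero_iff A l).mp (coeff_eq_zero_of_natDegree_lt (h.trans_lt hl))

end NagataRing

/-! ### One invertible minor over `R(t)`, and simple matrices -/

section Simple

variable {R : Type*} [CommRing R] {m n : ℕ}

theorem contentIdeal_X_pow_sub_X_pow {a b : ℕ} (h : a ≠ b) :
    ((X : R[X]) ^ a - X ^ b).contentIdeal = ⊤ := by
  rw [Ideal.eq_top_iff_one]
  have := coeff_mem_contentIdeal ((X : R[X]) ^ a - X ^ b) a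
  rwa [coeff_sub, coeff_X_pow_self, coeff_X_pow, if_neg h, sub_zero] at this

theorem isUnit_det_vandermonde_X_pow {w : Fin m → ℕ} (hw : Function.Injective w) :
    IsUnit (((vandermonde fun a => (X : R[X]) ^ w a).map (algebraMap R[X] (Nagata R))).det) := by
  rw [← RingHom.mapMatrix_apply, ← RingHom.map_det, det_vandermonde, map_prod]
  refine IsUnit.prod_univ_iff.mpr fun i => ?_
  rw [map_prod]
  refine IsUnit.prod_iff.mpr fun j hj => ?_
  exact isUnit_algebraMap_of_contentIdeal
    (contentIdeal_X_pow_sub_X_pow (hw.ne (Finset.mem_Ioi.mp hj).ne'))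

/-- Multiplying by Vandermonde matrices in sufficiently sparse powers of the indeterminate collects
all the minors of order `k` as the coefficients of one determinant. -/
theorem det_vandermonde_mul_mul {k w : ℕ} (hm : m ≤ w) (hn : n ≤ w) (A : Matrix (Fin m) (Fin n) R)
    (F : Matrix (Fin k) (Fin m) R[X]) (hF : ∀ a i, F a i = X ^ (w ^ (a : ℕ) * (i : ℕ)))
    (E : Matrix (Fin n) (Fin k) R[X]) (hE : ∀ j b, E j b = X ^ (w ^ (k + (b : ℕ)) * (j : ℕ))) :
    detIdeal k A ≤ (F * A.map C * E).det.contentIdeal := by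
  -- The exponent of the term indexed by `(f, g)` has the values of `f` and `g` as its `2k` digits
  -- in base `w`. Distinct pairs give distinct monomials, so no two minors are mixed.
  let e : (Fin k → Fin m) × (Fin k → Fin n) → ℕ := fun p =>
    finFunctionFinEquiv (Fin.append (fun a => Fin.castLE hm (p.1 a)) fun b => Fin.castLE hn (p.2 b))
  have he : Function.Injective e := by
    rintro ⟨f, g⟩ ⟨f', g'⟩ h
    have h := finFunctionFinEquiv.injective (Fin.val_injective h)
    ext a
    · simpa only [Fin.append_left, Fin.val_castLE] using congrArg Fin.val (congrFun h (Fin.castAdd k a))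
    · simpa only [Fin.append_right, Fin.val_castLE] using congrArg Fin.val (congrFun h (Fin.natAdd k a))
  have hdet : (F * A.map C * E).det = ∑ p : (Fin k → Fin m) × (Fin k → Fin n),
      C (A.submatrix p.1 p.2).det * X ^ e p := by
    rw [det_mul_mul_eq_sum, ← Fintype.sum_prod_type']
    refine Finset.sum_congr rfl fun p _ => ?_
    rw [RingHom.map_det, mul_comm]
    congr 1
    simp only [hF, hE, Finset.prod_pow_eq_pow_sum, ← pow_add]
    congr 1
    simp only [e, finFunctionFinEquiv_apply, Fin.sum_univ_add, Fin.append_left, Fin.append_right,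
      Fin.val_castLE, Fin.val_castAdd, Fin.val_natAdd, mul_comm]
  rw [detIdeal_le_iff]
  intro α β
  have hc : (F * A.map C * E).det.coeff (e (α, β)) = (A.submatrix α β).det := by
    rw [hdet, finsetSum_coeff]
    refine (Finset.sum_eq_single ((α : Fin k → Fin m), (β : Fin k → Fin n)) (fun p _ hp => ?_)
      (by simp)).trans (by simp)
    rw [coeff_C_mul, coeff_X_pow, if_neg (fun h => hp (he h).symm), mul_zero]
  rw [← hc]
  exact coeff_mem_contentIdeal _ _

/-- Over the Nagata ring, a matrix with coefficients in `R` whose minors of order `k` generate the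
unit ideal is equivalent to a matrix whose leading minor of order `k` is invertible. -/
theorem exists_isUnit_det {k : ℕ} {A : Matrix (Fin m) (Fin n) R} (h : detIdeal k A = ⊤)
    (hm : k ≤ m) (hn : k ≤ n) :
    ∃ (U : Matrix (Fin m) (Fin m) (Nagata R)) (V : Matrix (Fin n) (Fin n) (Nagata R)),
      IsUnit U.det ∧ IsUnit V.det ∧
      IsUnit (U.submatrix (Fin.castLE hm) id * overNagata A * V.submatrix id (Fin.castLE hn)).det := by
  -- Large enough for the digits in `Fin m` and `Fin n`, and at least `2`, so that the exponents `w
  -- ^ a` are distinct.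
  let w := m + n + 2
  have hw : Function.Injective fun a : ℕ => w ^ a := Nat.pow_right_injective (by omega)
  let U := vandermonde fun a : Fin m => (X : R[X]) ^ w ^ (a : ℕ)
  let V := (vandermonde fun b : Fin n => (X : R[X]) ^ w ^ (k + (b : ℕ)))ᵀ
  refine ⟨U.map (algebraMap R[X] (Nagata R)), V.map (algebraMap R[X] (Nagata R)),
    isUnit_det_vandermonde_X_pow fun a b hab => Fin.ext (hw hab), ?_, ?_⟩
  · rw [← det_transpose]
    exact isUnit_det_vandermonde_X_pow fun a b hab => Fin.ext (by have := hw hab; omega)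
  · have hle := det_vandermonde_mul_mul (w := w) (k := k) (by omega) (by omega) A
      (U.submatrix (Fin.castLE hm) id) (by intro a i; simp [U, vandermonde_apply, pow_mul])
      (V.submatrix id (Fin.castLE hn)) (by intro a i; simp [V, vandermonde_apply, pow_mul])
    rw [h, top_le_iff] at hle
    have := isUnit_algebraMap_of_contentIdeal hle
    rw [RingHom.map_det, RingHom.mapMatrix_apply, Matrix.map_mul, Matrix.map_mul,
      ← overNagata_eq] at this
    exact this

theorem subsingleton_of_detIdeal_eq_top {k : ℕ} {A : Matrix (Fin m) (Fin n) R}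
    (h : detIdeal k A = ⊤) (hk : ¬ (k ≤ m ∧ k ≤ n)) : Subsingleton R := by
  have hbot : detIdeal k A ≤ ⊥ := by
    rw [detIdeal_le_iff]
    intro α β
    refine (hk ⟨?_, ?_⟩).elim
    · simpa using Fintype.card_le_of_injective α α.injective
    · simpa using Fintype.card_le_of_injective β β.injective
  rw [h] at hbot
  exact subsingleton_of_zero_eq_one ((Ideal.mem_bot.mp (hbot (Submodule.mem_top (x := 1)))).symm)

theorem subsingleton_nagata [Subsingleton R] : Subsingleton (Nagata R) :=
  (algebraMap R (Nagata R)).codomain_trivial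

theorem exists_isUnit_det' {k : ℕ} {A : Matrix (Fin m) (Fin n) R} (h : detIdeal k A = ⊤) :
    ∃ (F : Matrix (Fin k) (Fin m) (Nagata R)) (E : Matrix (Fin n) (Fin k) (Nagata R)),
      IsUnit (F * overNagata A * E).det := by
  by_cases hk : k ≤ m ∧ k ≤ n
  · obtain ⟨U, V, -, -, h⟩ := exists_isUnit_det h hk.1 hk.2
    exact ⟨_, _, h⟩
  · have := subsingleton_of_detIdeal_eq_top h hk
    have := subsingleton_nagata (R := R)
    exact ⟨0, 0, isUnit_of_subsingleton _⟩

/-- The basis of `R^n` formed by the columns of an invertible matrix. -/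
theorem exists_basis_of_isUnit_det {κ : Type*} [Fintype κ] [DecidableEq κ] (σ : κ ≃ Fin n)
    (V : Matrix (Fin n) κ R) (hV : IsUnit (V.submatrix σ id).det) :
    ∃ b : Module.Basis κ R (Fin n → R), ∀ i, b i = V.col i := by
  set V' := V.submatrix σ id
  have h1 : V * ((V'⁻¹).submatrix id σ.symm) = 1 := by
    have : V = V'.submatrix σ.symm id := by
      ext i j; simp [V']
    rw [this]
    have h : V'.submatrix σ.symm id * (V'⁻¹).submatrix id σ.symm =
      (V' * V'⁻¹).submatrix σ.symm σ.symm := rfl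
    rw [h, mul_nonsing_inv _ hV, submatrix_one_equiv]
  have h2 : ((V'⁻¹).submatrix id σ.symm) * V = 1 := by
    have : V = V'.submatrix σ.symm id := by
      ext i j; simp [V']
    rw [this, submatrix_mul_equiv, nonsing_inv_mul _ hV, submatrix_id_id]
  refine ⟨Module.Basis.ofEquivFun (toLin'OfInv h1 h2), fun i => ?_⟩
  rw [Module.Basis.coe_ofEquivFun]
  ext j
  simp [toLin'OfInv]

/-- The factorization `M = M E₁ T` allows the last columns of `V` to be corrected by multiples of
`E₁` so that `M` kills them; `M E₁` is completed to a basis by the last columns of `U⁻¹`. -/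
theorem RankLE.simpleOfRank {k p q : ℕ} {M : Matrix (Fin (k + q)) (Fin (k + p)) R} (h : RankLE M k)
    {U : Matrix (Fin (k + q)) (Fin (k + q)) R} {V : Matrix (Fin (k + p)) (Fin (k + p)) R}
    (hU : IsUnit U.det) (hV : IsUnit V.det)
    (hG : IsUnit (U.submatrix (Fin.castAdd q) id * M * V.submatrix id (Fin.castAdd p)).det) :
    SimpleOfRank M k := by
  set F₁ := U.submatrix (Fin.castAdd q) id with hF₁
  set F₂ := U.submatrix (Fin.natAdd k) id with hF₂
  set E₁ := V.submatrix id (Fin.castAdd p) with hE₁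
  set E₂ := V.submatrix id (Fin.natAdd k) with hE₂
  set G := F₁ * M * E₁ with hGdef
  have hM := h.mul_inv_mul hG
  set T := G⁻¹ * (F₁ * M) with hT
  set U' := U⁻¹.submatrix id (Fin.natAdd k) with hU'
  have hF₁U' : F₁ * U' = 0 := by
    have : F₁ * U' = (U * U⁻¹).submatrix (Fin.castAdd q) (Fin.natAdd k) := rfl
    rw [this, mul_nonsing_inv _ hU]
    ext i j
    rw [submatrix_apply, one_apply_ne (by intro h; simp [Fin.ext_iff] at h; omega), Matrix.zero_apply]
  have hF₂U' : F₂ * U' = 1 := by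
    have : F₂ * U' = (U * U⁻¹).submatrix (Fin.natAdd k) (Fin.natAdd k) := rfl
    rw [this, mul_nonsing_inv _ hU]
    ext i j
    simp [one_apply]
  have hTE : T * E₁ = 1 := by
    rw [hT, Matrix.mul_assoc, ← hGdef, nonsing_inv_mul _ hG]
  let e : Matrix (Fin (k + p)) (Fin k ⊕ Fin p) R := fromCols E₁ (E₂ - E₁ * (T * E₂))
  let f : Matrix (Fin (k + q)) (Fin k ⊕ Fin q) R := fromCols (M * E₁) U'
  have he : IsUnit (e.submatrix finSumFinEquiv id).det := by
    let S : Matrix (Fin k ⊕ Fin p) (Fin k ⊕ Fin p) R := fromBlocks 1 (-(T * E₂)) 0 1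
    have h1 : e = (fromCols E₁ E₂) * S := by
      rw [fromCols_mul_fromBlocks]
      simp [e, neg_add_eq_sub]
    have h2 : (fromCols E₁ E₂).submatrix finSumFinEquiv id =
        V.submatrix finSumFinEquiv finSumFinEquiv := by
      ext i (j | j) <;> rfl
    have h3 : e.submatrix finSumFinEquiv id =
        (fromCols E₁ E₂).submatrix finSumFinEquiv id * S := by
      rw [h1]; rfl
    rw [h3, h2, det_mul, det_submatrix_equiv_self, det_fromBlocks_zero₂₁]
    simpa using hV
  have hf : IsUnit (f.submatrix finSumFinEquiv id).det := by
    have h1 : fromRows F₁ F₂ * f = fromBlocks G 0 (F₂ * (M * E₁)) 1 := by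
      rw [fromRows_mul_fromCols, hF₁U', hF₂U', ← Matrix.mul_assoc]
    have h2 : fromRows F₁ F₂ = U.submatrix finSumFinEquiv id := by
      ext (i | i) j <;> rfl
    have h3 : U.submatrix finSumFinEquiv id * f =
        U.submatrix finSumFinEquiv finSumFinEquiv * f.submatrix finSumFinEquiv id := by
      rw [submatrix_mul_equiv]
      rfl
    rw [h2, h3] at h1
    have h4 := congrArg det h1
    rw [det_mul, det_fromBlocks_zero₁₂, det_one, mul_one] at h4
    rw [← h4] at hG
    exact isUnit_of_mul_isUnit_right hG
  obtain ⟨be, hbe⟩ := exists_basis_of_isUnit_det _ e he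
  obtain ⟨bf, hbf⟩ := exists_basis_of_isUnit_det _ f hf
  refine ⟨p, q, be, bf, fun i => ?_, fun j => ?_⟩
  · rw [hbe, hbf]
    ext a
    simp [e, f, mulVec, dotProduct, Matrix.mul_apply]
  · rw [hbe]
    have h0 : M * (E₂ - E₁ * (T * E₂)) = 0 := by
      rw [Matrix.mul_sub, ← Matrix.mul_assoc, ← Matrix.mul_assoc, ← hM, sub_self]
    ext a
    have := congrFun (congrFun h0 a) j
    simpa [e, mulVec, dotProduct, Matrix.mul_apply (M := M)] using this

theorem HasRank.simpleOfRank_overNagata {k : ℕ} {A : Matrix (Fin m) (Fin n) R} (h : HasRank A k) :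
    SimpleOfRank (overNagata A) k := by
  by_cases hk : k ≤ m ∧ k ≤ n
  · obtain ⟨U, V, hU, hV, hG⟩ := exists_isUnit_det h.1 hk.1 hk.2
    obtain ⟨q, rfl⟩ := Nat.exists_eq_add_of_le hk.1
    obtain ⟨p, rfl⟩ := Nat.exists_eq_add_of_le hk.2
    exact RankLE.simpleOfRank (hasRank_iff.mp (hasRank_overNagata_iff.mpr h)).2 hU hV hG
  · have := subsingleton_of_detIdeal_eq_top h.1 hk
    have := subsingleton_nagata (R := R)
    refine ⟨0, 0, Module.Basis.ofEquivFun 0, Module.Basis.ofEquivFun 0,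
      fun _ => Subsingleton.elim _ _, fun _ => Subsingleton.elim _ _⟩

/-- The first `k` coordinates in the two bases give `M = F T` through `R^k` and `L M E = 1`. -/
theorem SimpleOfRank.hasRank {k : ℕ} {M : Matrix (Fin m) (Fin n) R} (h : SimpleOfRank M k) :
    HasRank M k := by
  obtain ⟨p, q, e, f, h1, h2⟩ := h
  let L : Matrix (Fin k) (Fin m) R := of fun a i => f.repr (Pi.single i 1) (Sum.inl a)
  let T : Matrix (Fin k) (Fin n) R := of fun a j => e.repr (Pi.single j 1) (Sum.inl a)
  let E : Matrix (Fin n) (Fin k) R := of fun j a => e (Sum.inl a) j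
  let F : Matrix (Fin m) (Fin k) R := of fun i a => f (Sum.inl a) i
  have hL : ∀ x a, (L *ᵥ x) a = f.repr x (Sum.inl a) := by
    intro x a
    conv_rhs => rw [pi_eq_sum_univ' x]
    simp [L, mulVec, dotProduct, mul_comm]
  have hT : ∀ x, T *ᵥ x = fun a => e.repr x (Sum.inl a) := by
    intro x
    ext1 a
    conv_rhs => rw [pi_eq_sum_univ' x]
    simp [T, mulVec, dotProduct, mul_comm]
  have hM : M = F * T := by
    apply (toLin' (R := R)).injective
    refine e.ext ?_
    rintro (a | j)
    · have hTa : T *ᵥ e (Sum.inl a) = Pi.single a 1 := by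
        ext b
        simp [hT, Finsupp.single_apply, Pi.single_apply, eq_comm]
      rw [toLin'_apply, toLin'_apply, h1, ← mulVec_mulVec, hTa, mulVec_single_one]
      rfl
    · have hTj : T *ᵥ e (Sum.inr j) = 0 := by
        ext b
        simp [hT]
      rw [toLin'_apply, toLin'_apply, h2, ← mulVec_mulVec, hTj, mulVec_zero]
  have hone : L * M * E = 1 := by
    ext a b
    have hE : M *ᵥ (E.col b) = f (Sum.inl b) := h1 b
    have : (L * M * E) a b = (L *ᵥ (M *ᵥ E.col b)) a := by
      rw [mulVec_mulVec]
      rfl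
    rw [this, hE, hL]
    simp [one_apply, Finsupp.single_apply, eq_comm]
  rw [hasRank_iff]
  refine ⟨detIdeal_eq_top_of_isUnit (F := L) (E := E) (by rw [hone]; simp), ?_⟩
  rw [hM]
  exact rankLE_mul F T

end Simple

/-! ### Crossed factorizations, and generalized inverses via a crossed matrix -/

section CrossedMatrices

variable {R : Type*} [CommRing R] {m n k : ℕ}

/-- The projection is `F (E F)⁻¹ E`. -/
theorem isCompl_im_ker {F : Matrix (Fin m) (Fin k) R} {E : Matrix (Fin k) (Fin m) R}
    (h : IsUnit (E * F).det) : IsCompl (im F) (ker E) := by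
  constructor
  · rw [Submodule.disjoint_def]
    rintro _ ⟨x, rfl⟩ hx
    have hx : E *ᵥ (F *ᵥ x) = 0 := hx
    rw [mulVec_mulVec] at hx
    have := congrArg ((E * F)⁻¹ *ᵥ ·) hx
    simp only [mulVec_mulVec, nonsing_inv_mul _ h, one_mulVec, mulVec_zero] at this
    rw [this, map_zero]
  · rw [codisjoint_iff, eq_top_iff]
    intro x _
    refine Submodule.mem_sup.mpr ⟨F *ᵥ ((E * F)⁻¹ *ᵥ (E *ᵥ x)), ⟨_, rfl⟩,
      x - F *ᵥ ((E * F)⁻¹ *ᵥ (E *ᵥ x)), ?_, add_sub_cancel _ _⟩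
    change E *ᵥ _ = 0
    rw [mulVec_sub, mulVec_mulVec _ E F, mulVec_mulVec _ (E * F), mul_nonsing_inv _ h, one_mulVec,
      sub_self]

theorem im_mul_of_rightInverse (F : Matrix (Fin m) (Fin k) R) {E : Matrix (Fin k) (Fin n) R}
    {X : Matrix (Fin n) (Fin k) R} (h : E * X = 1) : im (F * E) = im F := by
  apply le_antisymm
  · rintro _ ⟨x, rfl⟩
    exact ⟨E *ᵥ x, by simp only [mulVecLin_apply, mulVec_mulVec]⟩
  · rintro _ ⟨x, rfl⟩
    refine ⟨X *ᵥ x, ?_⟩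
    rw [mulVecLin_apply, mulVec_mulVec, Matrix.mul_assoc, h, Matrix.mul_one]
    rfl

theorem ker_mul_of_leftInverse {F : Matrix (Fin m) (Fin k) R} (E : Matrix (Fin k) (Fin n) R)
    {Y : Matrix (Fin k) (Fin m) R} (h : Y * F = 1) : ker (F * E) = ker E := by
  ext x
  change (F * E) *ᵥ x = 0 ↔ E *ᵥ x = 0
  rw [← mulVec_mulVec]
  refine ⟨fun hx => ?_, fun hx => by rw [hx, mulVec_zero]⟩
  have := congrArg (Y *ᵥ ·) hx
  simpa only [mulVec_mulVec, h, one_mulVec, mulVec_zero, ← Matrix.mul_assoc, Matrix.one_mul] using this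

theorem crossed_mul {F : Matrix (Fin m) (Fin k) R} {E : Matrix (Fin k) (Fin n) R}
    {F' : Matrix (Fin n) (Fin k) R} {E' : Matrix (Fin k) (Fin m) R}
    (h : IsUnit (E * F').det) (h' : IsUnit (E' * F).det) : Crossed (F * E) (F' * E') := by
  have h1 : E * (F' * (E * F')⁻¹) = 1 := by rw [← Matrix.mul_assoc, mul_nonsing_inv _ h]
  have h2 : (E * F')⁻¹ * E * F' = 1 := by rw [Matrix.mul_assoc, nonsing_inv_mul _ h]
  have h3 : E' * (F * (E' * F)⁻¹) = 1 := by rw [← Matrix.mul_assoc, mul_nonsing_inv _ h']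
  have h4 : (E' * F)⁻¹ * E' * F = 1 := by rw [Matrix.mul_assoc, nonsing_inv_mul _ h']
  rw [Crossed, im_mul_of_rightInverse F h1, im_mul_of_rightInverse F' h3,
    ker_mul_of_leftInverse E h4, ker_mul_of_leftInverse E' h2]
  exact ⟨isCompl_im_ker h', (isCompl_im_ker h).symm⟩

/-- Since `B = A' Y`, the relation `A B A A' = A A'` can be cancelled by `A` on `Im A'`, giving `B A
A' = A'`. The other identities follow from this and from `B = Y' A'`. -/
theorem Crossed.isGenInverseVia {A : Matrix (Fin m) (Fin n) R} {A' : Matrix (Fin n) (Fin m) R}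
    (h : Crossed A A') {B : Matrix (Fin n) (Fin m) R} (hB : A * B * A = A)
    {Y : Matrix (Fin m) (Fin m) R} (hY : B = A' * Y) {Y' : Matrix (Fin n) (Fin n) R}
    (hY' : B = Y' * A') : IsGenInverseVia A A' B := by
  have hA' : B * A * A' = A' := by
    have h0 : A * (A' * (Y * A * A' - 1)) = 0 := by
      rw [Matrix.mul_sub, Matrix.mul_one, ← Matrix.mul_assoc, ← Matrix.mul_assoc, ← hY,
        Matrix.mul_sub, ← Matrix.mul_assoc, ← Matrix.mul_assoc, hB, sub_self]
    have := h.symm.mul_eq_zero_of_mul_mul h0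
    rw [Matrix.mul_sub, Matrix.mul_one, ← Matrix.mul_assoc, ← Matrix.mul_assoc, ← hY,
      sub_eq_zero] at this
    exact this
  refine ⟨hB, ?_, ⟨h.1, ?_, ?_⟩, ⟨h.2.symm, ?_, ?_⟩⟩
  · conv_lhs => rw [Matrix.mul_assoc, hY, ← Matrix.mul_assoc, ← Matrix.mul_assoc, ← hY, hA']
    exact hY.symm
  · rintro _ ⟨x, rfl⟩
    rw [mulVecLin_apply, mulVec_mulVec, hB]
  · intro x hx
    have hx : A' *ᵥ x = 0 := hx
    rw [hY', ← Matrix.mul_assoc, ← mulVec_mulVec, hx, mulVec_zero]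
  · rintro _ ⟨x, rfl⟩
    rw [mulVecLin_apply, mulVec_mulVec, hA']
  · intro x hx
    have hx : A *ᵥ x = 0 := hx
    rw [← mulVec_mulVec, hx, mulVec_zero]

theorem IsProjection.unique {P P' : Matrix (Fin n) (Fin n) R} {I K : Submodule R (Fin n → R)}
    (h : IsProjection P I K) (h' : IsProjection P' I K) : P = P' := by
  apply (toLin' (R := R)).injective
  refine LinearMap.ext fun x => ?_
  obtain ⟨y, z, hy, hz, rfl⟩ := Submodule.codisjoint_iff_exists_add_eq.mp h.1.codisjoint x
  rw [toLin'_apply, toLin'_apply, mulVec_add, mulVec_add, h.2.1 y hy, h'.2.1 y hy, h.2.2 z hz,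
    h'.2.2 z hz]

/-- `B = B A B = B' A B = B' A B' = B'`. -/
theorem IsGenInverseVia.unique {A : Matrix (Fin m) (Fin n) R} {A' B B' : Matrix (Fin n) (Fin m) R}
    (h : IsGenInverseVia A A' B) (h' : IsGenInverseVia A A' B') : B = B' := by
  rw [← h.mul_mul_right, h.proj_right.unique h'.proj_right, Matrix.mul_assoc,
    h.proj_left.unique h'.proj_left, ← Matrix.mul_assoc, h'.mul_mul_right]

/-- A matrix with a generalized inverse whose minors of order `k` generate the unit ideal and whose
minors of order `k + 1` are nilpotent has rank `k`. -/
theorem rankLE_of_detIdeal_le_nilradical {M : Matrix (Fin m) (Fin n) R}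
    {N : Matrix (Fin n) (Fin m) R} (hN : M * N * M = M) {F : Matrix (Fin k) (Fin m) R}
    {E : Matrix (Fin n) (Fin k) R} (hG : IsUnit (F * M * E).det)
    (hnil : detIdeal (k + 1) M ≤ nilradical R) : RankLE M k := by
  set G := F * M * E with hGdef
  set T := E * G⁻¹ * F with hT
  have hTT : T * M * T = T := by
    calc T * M * T = E * (G⁻¹ * (F * M * E) * G⁻¹) * F := by simp only [hT, Matrix.mul_assoc]
      _ = T := by rw [← hGdef, nonsing_inv_mul _ hG, Matrix.one_mul]
  -- The obstruction to factoring `M` through `R^k`. By the Cramer rule its entries are nilpotent;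
  -- it also inherits `N` as an inner inverse, and together these force `D = 0`.
  set D := M - M * T * M with hD
  have hadj : G.det • D = G.det • M - M * (E * G.adjugate * F) * M := by
    have : G.det • G⁻¹ = G.adjugate := by
      rw [Matrix.inv_def, smul_smul, Ring.mul_inverse_cancel _ hG, one_smul]
    rw [hD, hT, ← this, smul_sub]
    simp only [Matrix.mul_smul, Matrix.smul_mul]
  have hDnil : ∀ i j, D i j ∈ nilradical R := by
    intro i j
    have := hnil (det_mul_schur_mem_detIdeal F M E i j)
    rw [← hGdef, ← hadj, Matrix.smul_apply, smul_eq_mul] at this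
    rwa [Ideal.unit_mul_mem_iff_mem _ hG, Ideal.unit_mul_mem_iff_mem _ hG] at this
  have hDND : D * N * D = D := by
    have h1 : D * N * D = M * N * M - M * N * M * T * M - M * T * (M * N * M) +
        M * T * (M * N * M) * T * M := by
      rw [hD]
      simp only [Matrix.sub_mul, Matrix.mul_sub, Matrix.mul_assoc]
      abel
    have h2 : M * T * M * T * M = M * T * M := by
      simp only [Matrix.mul_assoc]
      rw [← Matrix.mul_assoc T, ← Matrix.mul_assoc (T * M), hTT]
    rw [h1, hN, h2, hD]
    abel
  -- Modulo the nilradical `1 - D N` is the identity, so it is invertible, while `D N D = D` says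
  -- that it kills `D`.
  have hunit : IsUnit (1 - D * N).det := by
    have hmem : (1 - D * N).det - 1 ∈ nilradical R := by
      rw [← Ideal.Quotient.eq, RingHom.map_det, map_one]
      have : (Ideal.Quotient.mk (nilradical R)).mapMatrix (1 - D * N) = 1 := by
        rw [map_sub, map_one, sub_eq_self]
        ext i j
        simp only [RingHom.mapMatrix_apply, Matrix.map_apply, Matrix.zero_apply]
        rw [Ideal.Quotient.eq_zero_iff_mem, Matrix.mul_apply]
        exact sum_mem fun l _ => Ideal.mul_mem_right _ _ (hDnil i l)
      rw [this, det_one]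
    have := IsNilpotent.isUnit_add_one (mem_nilradical.mp hmem)
    rwa [sub_add_cancel] at this
  have hD0 : D = 0 := by
    have h0 : (1 - D * N) * D = 0 := by rw [Matrix.sub_mul, Matrix.one_mul, hDND, sub_self]
    have := congrArg ((1 - D * N)⁻¹ * ·) h0
    simpa only [← Matrix.mul_assoc, nonsing_inv_mul _ hunit, Matrix.one_mul, Matrix.mul_zero]
      using this
  have hM : M = M * E * (G⁻¹ * F * M) := by
    rw [hD, sub_eq_zero] at hD0
    simpa only [hT, Matrix.mul_assoc] using hD0
  rw [hM]
  exact rankLE_mul _ _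

end CrossedMatrices

/-! ### The implications between the conditions -/

section Main

variable {R : Type*} [CommRing R] {m n k : ℕ} {A : Matrix (Fin m) (Fin n) R}

theorem HasRank.gramPrimitive (h : HasRank A k) : GramPrimitive A k :=
  gramPrimitive_of_contentIdeal h.contentIdeal_gramNum

/-- Over the Nagata ring, a matrix of rank `k` has a full rank factorization. -/
theorem HasRank.exists_factorization (h : HasRank A k) :
    ∃ (F : Matrix (Fin m) (Fin k) (Nagata R)) (E : Matrix (Fin k) (Fin n) (Nagata R)),
      overNagata A = F * E := by
  obtain ⟨F, E, hG⟩ := exists_isUnit_det' h.1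
  exact ⟨_, _, (hasRank_iff.mp (hasRank_overNagata_iff.mpr h)).2.mul_inv_mul hG⟩

theorem HasRank.natDegree_gramPoly_le (h : HasRank A k) : (gramPoly A).natDegree ≤ k := by
  obtain ⟨F, E, hA⟩ := h.exists_factorization
  rw [gramPoly, hA, Matrix.mul_assoc, detPoly_mul_comm]
  exact natDegree_detPoly_le _

theorem HasRank.mul_genAdj_mul (h : HasRank A k) :
    overNagata A * genAdj k (overNagata A) (circ A) * overNagata A = gram A k • overNagata A := by
  obtain ⟨F, E, hA⟩ := h.exists_factorization
  rw [gram, gramPoly, hA]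
  exact mul_genAdj_mul_of_factor F E (circ A)

theorem HasRank.crossedOfRank (h : HasRank A k) : CrossedOfRank (overNagata A) (circ A) k := by
  obtain ⟨F, E, hA⟩ := h.exists_factorization
  have hcirc : circ A = ((Q R n)⁻¹ * Eᵀ) * (Fᵀ * Q R m) := by
    rw [circ, hA, transpose_mul]
    simp only [Matrix.mul_assoc]
  have hg := h.gramPrimitive.isUnit_gram
  have hE : E * circ A * F = (E * ((Q R n)⁻¹ * Eᵀ)) * ((Fᵀ * Q R m) * F) := by
    rw [hcirc]
    simp only [Matrix.mul_assoc]
  -- After moving `F` to the right, `g_k` is the top coefficient for a `k × k` matrix, namely `det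
  -- (E A° F)`. This unit serves both as a generic minor of `A°` and, once split, as the condition
  -- for crossedness.
  rw [gram, gramPoly, hA, Matrix.mul_assoc, detPoly_mul_comm, coeff_detPoly_self] at hg
  refine ⟨?_, hasRank_overNagata_iff.mpr h, hasRank_iff.mpr
    ⟨detIdeal_eq_top_of_isUnit hg, ?_⟩⟩
  · rw [hE, det_mul] at hg
    rw [hA, hcirc]
    exact crossed_mul (isUnit_of_mul_isUnit_left hg) (isUnit_of_mul_isUnit_right hg)
  · rw [hcirc]
    exact rankLE_mul _ _

theorem hasRank_of_mul_genAdj_mul (hdeg : (gramPoly A).natDegree ≤ k) (hg : GramPrimitive A k)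
    (h : overNagata A * genAdj k (overNagata A) (circ A) * overNagata A =
      gram A k • overNagata A) : HasRank A k := by
  obtain ⟨F, E, hG⟩ := exists_isUnit_det' hg.detIdeal_eq_top
  have hN : overNagata A * (Ring.inverse (gram A k) • genAdj k (overNagata A) (circ A)) *
      overNagata A = overNagata A := by
    rw [Matrix.mul_smul, Matrix.smul_mul, h, smul_smul, Ring.inverse_mul_cancel _ hg.isUnit_gram,
      one_smul]
  have hnil : detIdeal (k + 1) (overNagata A) ≤ nilradical (Nagata R) := by
    rw [overNagata, detIdeal_map, Ideal.map_le_iff_le_comap]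
    intro r hr
    exact (mem_nilradical.mp (detIdeal_le_nilradical_of_natDegree_gramPoly hdeg hr)).map _
  rw [← hasRank_overNagata_iff, hasRank_iff]
  refine ⟨?_, rankLE_of_detIdeal_le_nilradical hN hG hnil⟩
  rw [overNagata, detIdeal_map, hg.detIdeal_eq_top, Ideal.map_top]

theorem mul_genAdj_mul_of_crossed (h : Crossed (overNagata A) (circ A))
    (hdeg : (gramPoly A).natDegree ≤ k) (hg : GramPrimitive A k) :
    overNagata A * genAdj k (overNagata A) (circ A) * overNagata A =
      gram A k • overNagata A := by
  by_cases hk : k ≤ m ∧ k ≤ n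
  · exact h.mul_genAdj_mul hk.1 hdeg
  · have := subsingleton_of_detIdeal_eq_top hg.detIdeal_eq_top hk
    have := subsingleton_nagata (R := R)
    exact Subsingleton.elim _ _

theorem HasRank.isGenInverseVia (h : HasRank A k) :
    IsGenInverseVia (overNagata A) (circ A)
      (Ring.inverse (gram A k) • genAdj k (overNagata A) (circ A)) := by
  obtain ⟨Y, hY⟩ := genAdj_eq_mul k (overNagata A) (circ A)
  obtain ⟨Y', hY'⟩ := genAdj_eq_mul' k (overNagata A) (circ A)
  refine h.crossedOfRank.1.isGenInverseVia ?_
    (Y := Ring.inverse (gram A k) • Y) (by rw [Matrix.mul_smul, hY])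
    (Y' := Ring.inverse (gram A k) • Y') (by rw [Matrix.smul_mul, hY'])
  rw [Matrix.mul_smul, Matrix.smul_mul, h.mul_genAdj_mul, smul_smul,
    Ring.inverse_mul_cancel _ h.gramPrimitive.isUnit_gram, one_smul]

end Main

end GenInv

theorem mainTheorem1 {R : Type*} [CommRing R] {m n : ℕ} (A : Matrix (Fin m) (Fin n) R) (k : ℕ) :
    -- the equivalence of the seven conditions
    List.TFAE
      [ GenInv.LocallySimpleOfRank A k,
        GenInv.LocallySimpleOfRank (GenInv.overNagata A) k,
        GenInv.SimpleOfRank (GenInv.overNagata A) k,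
        GenInv.RankLE A k ∧ GenInv.GramPrimitive A k,
        GenInv.CrossedOfRank (GenInv.overNagata A) (GenInv.circ A) k,
        GenInv.Crossed (GenInv.overNagata A) (GenInv.circ A) ∧
          (GenInv.gramPoly A).natDegree ≤ k ∧ GenInv.GramPrimitive A k,
        (GenInv.gramPoly A).natDegree ≤ k ∧ GenInv.GramPrimitive A k ∧
          GenInv.overNagata A * GenInv.genAdj k (GenInv.overNagata A) (GenInv.circ A) *
              GenInv.overNagata A =
            GenInv.gram A k • GenInv.overNagata A ] ∧
    -- over a reduced ring, the equation in the last condition can be dropped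
    (IsReduced R →
      (GenInv.LocallySimpleOfRank A k ↔
        (GenInv.gramPoly A).natDegree ≤ k ∧ GenInv.GramPrimitive A k)) ∧
    -- when the conditions hold, `Adj / g_k` is the generalized inverse of `A` via `A°` over `R(t)`
    (GenInv.LocallySimpleOfRank A k →
      IsUnit (GenInv.gram A k) ∧
      ∀ B : Matrix (Fin n) (Fin m) (GenInv.Nagata R),
        GenInv.IsGenInverseVia (GenInv.overNagata A) (GenInv.circ A) B ↔
          B = Ring.inverse (GenInv.gram A k) •
            GenInv.genAdj k (GenInv.overNagata A) (GenInv.circ A)) := by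
  rw [GenInv.locallySimpleOfRank_iff, GenInv.locallySimpleOfRank_iff]
  refine ⟨?_, fun hred => ⟨fun h => ⟨h.natDegree_gramPoly_le, h.gramPrimitive⟩, ?_⟩, fun h =>
    ⟨h.gramPrimitive.isUnit_gram, fun B => ⟨fun hB => hB.unique h.isGenInverseVia, ?_⟩⟩⟩
  · tfae_have 1 ↔ 2 := GenInv.hasRank_overNagata_iff.symm
    tfae_have 1 → 3 := fun h => h.simpleOfRank_overNagata
    tfae_have 3 → 2 := fun h => h.hasRank
    tfae_have 1 → 4 := fun h => ⟨(GenInv.hasRank_iff.mp h).2, h.gramPrimitive⟩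
    tfae_have 4 → 1 := fun h => GenInv.hasRank_iff.mpr ⟨h.2.detIdeal_eq_top, h.1⟩
    tfae_have 1 → 5 := fun h => h.crossedOfRank
    tfae_have 5 → 2 := fun h => h.2.1
    tfae_have 1 → 6 := fun h => ⟨h.crossedOfRank.1, h.natDegree_gramPoly_le, h.gramPrimitive⟩
    tfae_have 6 → 7 := fun h => ⟨h.2.1, h.2.2, GenInv.mul_genAdj_mul_of_crossed h.1 h.2.1 h.2.2⟩
    tfae_have 7 → 1 := fun h => GenInv.hasRank_of_mul_genAdj_mul h.1 h.2.1 h.2.2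
    tfae_finish
  · rintro ⟨hdeg, hg⟩
    refine ⟨hg.detIdeal_eq_top, ?_⟩
    rw [← le_bot_iff, ← Ideal.zero_eq_bot, ← nilradical_eq_zero R]
    exact GenInv.detIdeal_le_nilradical_of_natDegree_gramPoly hdeg
  · rintro rfl
    exact h.isGenInverseVia
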